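/- **Setting.** Let $1\le k<m<d-k$ and $n\ge 1$ be integers. Let $B_\star,B_0\in\mathbb R^{k\times d}$ have orthonormal rows, let $v_\star\in\mathbb R^k$ and $w_\star=B_\star^\top v_\star\neq 0$, and let $R_\star=\mathrm{rowspace}(B_\star)$. Let $F\in\mathbb R^{d\times m}$ have orthonormal columns, and let $S=\mathrm{range}(F)$ (the ID subspace). The training inputs, i.e. the rows of $X\in\mathbb R^{n\times d}$, are i.i.d. copies of $Fz$ with $z\sim N(0,I_m)$; the training outputs are $Y=XB_\star^\top v_\star$; the initial head $v_0\sim N(0,\sigma^2I_k)$, for some $\sigma^2\ge 0$, is independent of $X$. Let $\hat L(v,B)=\|XB^\top v-Y\|_2^2$. * *Fine-tuning* is the gradient flow $\dot v_{\mathrm{ft}}=-\nabla_v\hat L(v_{\mathrm{ft}},B_{\mathrm{ft}})$, $\dot B_{\mathrm{ft}}=-\nabla_B\hat L(v_{\mathrm{ft}},B_{\mathrm{ft}})$ on $[0,\infty)$ with $(v_{\mathrm{ft}},B_{\mathrm{ft}})(0)=(v_0,B_0)$. * *Linear probing* is the gradient flow $\dot v_{\mathrm{lp}}=-\nabla_v\hat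 L(v_{\mathrm{lp}},B_0)$ on $[0,\infty)$ with $v_{\mathrm{lp}}(0)=v_0$, and $v_{\mathrm{lp}}^\infty=\lim_{t\to\infty}v_{\mathrm{lp}}(t)$. The OOD distribution $P_{\mathrm{ood}}$ is a probability measure on $\mathbb R^d$ with finite and invertible second moment matrix $\Sigma=\mathbb E_{x\sim P_{\mathrm{ood}}}[xx^\top]$, and $L_{\mathrm{ood}}(v,B)=\mathbb E_{x\sim P_{\mathrm{ood}}}[(v_\star^\top B_\star x-v^\top Bx)^2]$. Write $d(B,B')=\min_U\|B-UB'\|_2$ (operator norm), the minimum being over orthogonal matrices $U\in\mathbb R^{k\times k}$. For nonzero subspaces $R,T$ of $\mathbb R^d$ let $\cos\angle(R,T)$ be the cosine of their largest principal angle: the $\min(\dim R,\dim T)$-th largest singular value of $E^\top G$, where the columns of $E$ and of $G$ are orthonormal bases of $R$ and of $T$. **Theorem.** For every $W>0$ and $\kappa\ge 1$ there is a constant $c>0$, depending on $W$ and $\kappa$ only, such that the following holds for all $n,d,k,m,v_\star,B_\star,B_0,F,P_{\mathrm{ood}},\sigma^2$ as above with $\|w_\star\|_2=W$ and $\|\Sigma\|_2\|\Sigma^{-1}\|_2\le\kappa$,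 and for all $\delta\in(0,1]$. Assume $\cos\angle(R_\star,S)>0$, $\cos\angle(R_\star,S^\perp)>0$, $n\ge 5m$ and $n\ge 10\log\frac1\delta$. If $$d(B_0,B_\star)< c\cdot\frac{\cos\angle(R_\star,S^\perp)\,\bigl(\cos\angle(R_\star,S)\bigr)^2\,\delta^2}{\sqrt k\,\log(n/\delta)},$$ then with probability at least $1-\delta$ over $(X,v_0)$ the limit $v_{\mathrm{lp}}^\infty$ and the fine-tuning trajectory exist, and $$L_{\mathrm{ood}}(v_{\mathrm{lp}}^\infty,B_0)<\inf_{t\ge 0}L_{\mathrm{ood}}(v_{\mathrm{ft}}(t),B_{\mathrm{ft}}(t)).$$ -/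

import Mathlib

open MeasureTheory ProbabilityTheory Filter Topology
open scoped Matrix NNReal

namespace LinearTransfer

noncomputable section

/-! ### Linear algebra -/

/-- The Euclidean norm of a vector of `ℝ^d`. -/
def euclNorm {d : ℕ} (x : Fin d → ℝ) : ℝ := ‖WithLp.toLp 2 x‖

/-- The operator norm `‖A‖₂` (largest singular value) of a real matrix. -/
def matOpNorm {p q : ℕ} (A : Matrix (Fin p) (Fin q) ℝ) : ℝ :=
  ‖LinearMap.toContinuousLinearMap (Matrix.toEuclideanLin A)‖

/-- The spectral condition number `‖A‖₂ ‖A⁻¹‖₂` of an invertible matrix; for a symmetric positive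
definite matrix it is the ratio of its extreme eigenvalues. -/
def condNumber {d : ℕ} (A : Matrix (Fin d) (Fin d) ℝ) : ℝ := matOpNorm A * matOpNorm A⁻¹

/-- The row space of a matrix, as a subspace of Euclidean space. -/
def rowSpace {k d : ℕ} (B : Matrix (Fin k) (Fin d) ℝ) : Submodule ℝ (EuclideanSpace ℝ (Fin d)) :=
  Submodule.span ℝ (Set.range fun i => WithLp.toLp 2 (B i))

/-- The column space of a matrix, as a subspace of Euclidean space. -/
def colSpace {d m : ℕ} (F : Matrix (Fin d) (Fin m) ℝ) : Submodule ℝ (EuclideanSpace ℝ (Fin d)) :=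
  rowSpace Fᵀ

/-- The cosine of the largest principal angle between two nonzero subspaces `R`, `S`: the `r`-th
largest singular value, `r = min (dim R) (dim S)`, of the orthogonal projection onto `S` restricted
to `R`. In orthonormal bases (the columns of `E` for `R` and of `F` for `S`) this map has the matrix
`Fᵀ E`, whose `r` leading singular values are those of `Eᵀ F`. Mathlib numbers the singular values
from `0`, in decreasing order. -/
def cosMaxAngle {d : ℕ} (R S : Submodule ℝ (EuclideanSpace ℝ (Fin d))) : ℝ :=
  ((S.orthogonalProjectionOnto : EuclideanSpace ℝ (Fin d) →ₗ[ℝ] S) ∘ₗ R.subtype).singularValues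
    (min (Module.finrank ℝ R) (Module.finrank ℝ S) - 1)

/-- The distance `min_U ‖B - U B'‖₂` of two feature extractors, over the orthogonal `k × k` matrices
`U` (a compact set, so that the infimum is attained). -/
def featureDist {k d : ℕ} (B B' : Matrix (Fin k) (Fin d) ℝ) : ℝ :=
  ⨅ U : Matrix.orthogonalGroup (Fin k) ℝ, matOpNorm (B - (U : Matrix (Fin k) (Fin k) ℝ) * B')

/-! ### Data -/

/-- The in-distribution covariates: the law of `F z` with `z ∼ N(0, I_m)`. -/
def idDistribution {d m : ℕ} (F : Matrix (Fin d) (Fin m) ℝ) : Measure (Fin d → ℝ) :=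
  (Measure.pi fun _ : Fin m => gaussianReal 0 1).map fun z => F *ᵥ z

/-- The initial head: `N(0, s I_k)`, where `s` is the variance. -/
def headDistribution (k : ℕ) (s : ℝ≥0) : Measure (Fin k → ℝ) :=
  Measure.pi fun _ : Fin k => gaussianReal 0 s

/-- The joint law of `n` i.i.d. training inputs and the (independent) initial head. -/
def sampleLaw {d m : ℕ} (n k : ℕ) (F : Matrix (Fin d) (Fin m) ℝ) (s : ℝ≥0) :
    Measure ((Fin n → Fin d → ℝ) × (Fin k → ℝ)) :=
  (Measure.pi fun _ : Fin n => idDistribution F).prod (headDistribution k s)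

/-- The matrix of second moments `E[x xᵀ]`. -/
def secondMoment {d : ℕ} (P : Measure (Fin d → ℝ)) : Matrix (Fin d) (Fin d) ℝ :=
  Matrix.of fun i j => ∫ x, x i * x j ∂P

/-! ### Losses -/

/-- The prediction `vᵀ B x` of the two-layer linear network. -/
def predict {k d : ℕ} (v : Fin k → ℝ) (B : Matrix (Fin k) (Fin d) ℝ) (x : Fin d → ℝ) : ℝ :=
  v ⬝ᵥ (B *ᵥ x)

/-- The out-of-distribution error `E_{x ∼ P}[(v⋆ᵀ B⋆ x - vᵀ B x)²]`. -/
def oodLoss {k d : ℕ} (P : Measure (Fin d → ℝ)) (vs : Fin k → ℝ) (Bs : Matrix (Fin k) (Fin d) ℝ)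
    (v : Fin k → ℝ) (B : Matrix (Fin k) (Fin d) ℝ) : ℝ :=
  ∫ x, (predict vs Bs x - predict v B x) ^ 2 ∂P

/-- The training outputs `Y = X B⋆ᵀ v⋆`; the rows of `X` are the training inputs. -/
def labels {n k d : ℕ} (X : Matrix (Fin n) (Fin d) ℝ) (vs : Fin k → ℝ)
    (Bs : Matrix (Fin k) (Fin d) ℝ) : Fin n → ℝ :=
  fun i => predict vs Bs (X i)

/-- The training loss `‖X Bᵀ v - Y‖₂²`. -/
def trainLoss {n k d : ℕ} (X : Matrix (Fin n) (Fin d) ℝ) (Y : Fin n → ℝ)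
    (v : Fin k → ℝ) (B : Matrix (Fin k) (Fin d) ℝ) : ℝ :=
  ∑ i, (predict v B (X i) - Y i) ^ 2

/-! ### Training by gradient flow -/

/-- `∂/∂v_i` of the training loss at `(v, B)`. -/
def headPartial {n k d : ℕ} (X : Matrix (Fin n) (Fin d) ℝ) (Y : Fin n → ℝ)
    (v : Fin k → ℝ) (B : Matrix (Fin k) (Fin d) ℝ) (i : Fin k) : ℝ :=
  deriv (fun h : ℝ => trainLoss X Y (v + Pi.single i h) B) 0

/-- `∂/∂B_ij` of the training loss at `(v, B)`. -/
def featurePartial {n k d : ℕ} (X : Matrix (Fin n) (Fin d) ℝ) (Y : Fin n → ℝ)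
    (v : Fin k → ℝ) (B : Matrix (Fin k) (Fin d) ℝ) (i : Fin k) (j : Fin d) : ℝ :=
  deriv (fun h : ℝ => trainLoss X Y v (B + Matrix.single i j h)) 0

/-- Fine-tuning: `(v, B)` follows on `[0, ∞)` the gradient flow of the training loss in both
arguments, from the initial value `(v₀, B₀)`. -/
def IsFineTuningFlow {n k d : ℕ} (X : Matrix (Fin n) (Fin d) ℝ) (Y : Fin n → ℝ)
    (v₀ : Fin k → ℝ) (B₀ : Matrix (Fin k) (Fin d) ℝ)
    (v : ℝ → Fin k → ℝ) (B : ℝ → Matrix (Fin k) (Fin d) ℝ) : Prop :=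
  v 0 = v₀ ∧ B 0 = B₀ ∧ ∀ t : ℝ, 0 ≤ t →
    (∀ i, HasDerivWithinAt (fun s => v s i) (-headPartial X Y (v t) (B t) i) (Set.Ici 0) t) ∧
    (∀ i j, HasDerivWithinAt (fun s => B s i j) (-featurePartial X Y (v t) (B t) i j)
      (Set.Ici 0) t)

/-- Linear probing: `v` follows on `[0, ∞)` the gradient flow of the training loss in the head
alone, from the initial value `v₀`, the features being frozen at `B₀`. -/
def IsLinearProbingFlow {n k d : ℕ} (X : Matrix (Fin n) (Fin d) ℝ) (Y : Fin n → ℝ)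
    (v₀ : Fin k → ℝ) (B₀ : Matrix (Fin k) (Fin d) ℝ) (v : ℝ → Fin k → ℝ) : Prop :=
  v 0 = v₀ ∧ ∀ t : ℝ, 0 ≤ t →
    ∀ i, HasDerivWithinAt (fun s => v s i) (-headPartial X Y (v t) B₀ i) (Set.Ici 0) t

/-- `w` is the limit, as time tends to infinity, of the head trained by linear probing. -/
def IsLinearProbingLimit {n k d : ℕ} (X : Matrix (Fin n) (Fin d) ℝ) (Y : Fin n → ℝ)
    (v₀ : Fin k → ℝ) (B₀ : Matrix (Fin k) (Fin d) ℝ) (w : Fin k → ℝ) : Prop :=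
  ∃ v : ℝ → Fin k → ℝ, IsLinearProbingFlow X Y v₀ B₀ v ∧ Tendsto v atTop (𝓝 w)

end

end LinearTransfer

open LinearTransfer

/-!
Write `w = B⋆ᵀ v⋆`, let `U` be an orthogonal matrix with `‖B₀ - U B⋆‖ < ε`, and put `Bu = U B⋆` and
`u = U v⋆`, so that `Buᵀ u = w`. By `oodLoss_eq` the OOD loss of `(v, B)` is the quadratic form of the
second moment matrix at `Bᵀ v - w`; hence the losses are separated, up to the condition number, as
soon as the errors `‖Bᵀ v - w‖` are (`oodLoss_lt_iInf`).

*Fine-tuning stays away from `w`.* The flow exists for all times because the pairing of the vector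
field with its argument is bounded above (`exists_solution_Ici_of_inner_le`), and it has two
conservation laws: `B` does not change on the orthogonal complement of the training inputs
(`IsFineTuningFlow.mulVec_eq`), and `v vᵀ - B Bᵀ` is constant (`IsFineTuningFlow.sq_sub_sq_eq`). If
`Bᵀ v` is close to `w`, the first law, projected to the complement of the ID subspace, shows that the
head `v` is close to `u`, and `Bᵀ u` is then close to `w`. The second law, tested on `u`, now reads
`(v₀ᵀ u)² ≈ ‖u‖⁴` (`le_euclNorm_sub_of_conserved`). But `v₀ᵀ u` is a centred Gaussian variable, and
its square is unlikely to be close to the nonzero number `‖u‖⁴`, whatever the variance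
(`gaussianReal_abs_sq_sub_lt_le`).

*Linear probing comes close to `w`.* When `X B₀ᵀ` is bounded from below by `τ`, the flow converges
to the least squares head (`IsLinearProbingFlow.tendsto`), whose distance to `u` is at most
`‖X (B₀ᵀ u - w)‖ / τ` (`euclNorm_sub_le_of_normal_equations`). The numerator is controlled by Markov's
inequality. For `τ` of order `√(n δ / k)` the lower bound fails with small probability
(`measure_exists_euclNorm_lt_le`), by a volume argument instead of a net: the integral of
`exp (-l ‖X B₀ᵀ a‖² / 2)` over an annulus of vectors `a` (`annulusWeight`) has an expectation that is
explicitly bounded, and it is not small if `X B₀ᵀ` is short on one unit vector, since it is then short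
on a whole ball around it. The hypothesis `5 m ≤ n` pays for the ratio of the volumes.

The factor `log (n / δ)` in the assumption enters only through being at least `1`.
-/

/-! ### Global existence for dissipative vector fields -/

section GlobalExistence

variable {E : Type*} [NormedAddCommGroup E] [InnerProductSpace ℝ E]

/-- Along a solution of `x' = G x` with `⟪x, G x⟫ ≤ C`, the squared norm grows at most linearly. -/
theorem norm_sq_le_of_inner_le {G : E → E} {C T : ℝ}
    (hC : ∀ x, inner ℝ x (G x) ≤ C) {γ : ℝ → E}
    (hγ : ∀ t ∈ Set.Icc 0 T, HasDerivWithinAt γ (G (γ t)) (Set.Icc 0 T) t)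
    {t : ℝ} (ht : t ∈ Set.Icc 0 T) : ‖γ t‖ ^ 2 ≤ ‖γ 0‖ ^ 2 + 2 * C * t := by
  have hcont : ContinuousOn γ (Set.Icc 0 T) := fun s hs => (hγ s hs).continuousWithinAt
  refine image_le_of_deriv_right_le_deriv_boundary (f := fun s => ‖γ s‖ ^ 2)
    (f' := fun s => 2 * inner ℝ (γ s) (G (γ s))) (B := fun s => ‖γ 0‖ ^ 2 + 2 * C * s)
    (B' := fun _ => 2 * C) (a := 0) (b := T) (by fun_prop) ?_ (by simp) (by fun_prop) ?_ ?_ ht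
  · intro s hs
    exact ((hγ s (Set.Ico_subset_Icc_self hs)).mono_of_mem_nhdsWithin
      (Icc_mem_nhdsGE_of_mem hs)).norm_sq
  · intro s _
    simpa using (((hasDerivAt_id s).const_mul (2 * C)).const_add
      (‖γ 0‖ ^ 2)).hasDerivWithinAt (s := Set.Ici s)
  · intro s _
    linarith [hC (γ s)]

/-- A `C¹` vector field with `⟪x, F x⟫ ≤ C` agrees on a given ball with a bounded and globally
Lipschitz one, subject to the same inequality. -/
theorem exists_lipschitz_cutoff [FiniteDimensional ℝ E] {F : E → E} (hF : ContDiff ℝ 1 F) {C : ℝ}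
    (hC₀ : 0 ≤ C) (hC : ∀ x, inner ℝ x (F x) ≤ C) {R : ℝ} (hR : 0 < R) :
    ∃ (G : E → E) (K L : ℝ≥0), LipschitzWith K G ∧ (∀ x, ‖G x‖ ≤ L) ∧
      (∀ x, ‖x‖ ≤ R → G x = F x) ∧ ∀ x, inner ℝ x (G x) ≤ C := by
  -- multiply `F` by a bump function that is `1` on the ball and `0` far away
  let χ : ContDiffBump (0 : E) := ⟨R, R + 1, hR, by linarith⟩
  have hG : ContDiff ℝ 1 fun x => χ x • F x := χ.contDiff.smul hF
  have hsupp : HasCompactSupport fun x => χ x • F x := χ.hasCompactSupport.smul_right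
  obtain ⟨K, hK⟩ := hG.lipschitzWith_of_hasCompactSupport hsupp (by norm_num)
  obtain ⟨L, hL⟩ := hsupp.exists_bound_of_continuous hG.continuous
  refine ⟨fun x => χ x • F x, K, L.toNNReal, hK, fun x => (hL x).trans (Real.le_coe_toNNReal L),
    fun x hx => ?_, fun x => ?_⟩
  · have : χ x = 1 := χ.one_of_mem_closedBall (by simpa using hx)
    simp [this]
  · rw [inner_smul_right]
    have h0 : 0 ≤ χ x := χ.nonneg
    have h1 : χ x ≤ 1 := χ.le_one
    nlinarith [hC x, mul_le_mul_of_nonneg_left (hC x) h0]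

/-- Solutions of `x' = F x` on `[0, S]` and on `[0, T]` with the same initial value agree on
`[0, S]`, when `S ≤ T`: both stay in a ball where `F` is Lipschitz. -/
theorem eqOn_of_inner_le [FiniteDimensional ℝ E] {F : E → E} (hF : ContDiff ℝ 1 F) {C : ℝ}
    (hC₀ : 0 ≤ C) (hC : ∀ x, inner ℝ x (F x) ≤ C) {S T : ℝ} (hST : S ≤ T) {γ₁ γ₂ : ℝ → E}
    (h₁ : ∀ t ∈ Set.Icc 0 S, HasDerivWithinAt γ₁ (F (γ₁ t)) (Set.Icc 0 S) t)
    (h₂ : ∀ t ∈ Set.Icc 0 T, HasDerivWithinAt γ₂ (F (γ₂ t)) (Set.Icc 0 T) t)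
    (h₀ : γ₁ 0 = γ₂ 0) : Set.EqOn γ₁ γ₂ (Set.Icc 0 S) := by
  have hsub : Set.Icc 0 S ⊆ Set.Icc 0 T := Set.Icc_subset_Icc_right hST
  replace h₂ : ∀ t ∈ Set.Icc 0 S, HasDerivWithinAt γ₂ (F (γ₂ t)) (Set.Icc 0 S) t :=
    fun t ht => (h₂ t (hsub ht)).mono hsub
  set R : ℝ := √(‖γ₁ 0‖ ^ 2 + 2 * C * S) + 1 with hR
  obtain ⟨G, K, L, hK, -, hGF, -⟩ := exists_lipschitz_cutoff hF hC₀ hC (R := R) (by positivity)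
  have key : ∀ γ : ℝ → E, γ 0 = γ₁ 0 →
      (∀ t ∈ Set.Icc 0 S, HasDerivWithinAt γ (F (γ t)) (Set.Icc 0 S) t) →
      ContinuousOn γ (Set.Icc 0 S) ∧
        ∀ t ∈ Set.Ico 0 S, HasDerivWithinAt γ (G (γ t)) (Set.Ici t) t := by
    intro γ hγ₀ hγ
    refine ⟨fun s hs => (hγ s hs).continuousWithinAt, fun t ht => ?_⟩
    have ht' := Set.Ico_subset_Icc_self ht
    have hn := norm_sq_le_of_inner_le hC hγ ht'
    rw [hγ₀] at hn
    have hle : ‖γ t‖ ≤ R := by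
      have : ‖γ t‖ ≤ √(‖γ₁ 0‖ ^ 2 + 2 * C * S) := by
        apply Real.le_sqrt_of_sq_le
        have := mul_le_mul_of_nonneg_left ht'.2 hC₀
        linarith
      linarith
    rw [hGF _ hle]
    exact (hγ t ht').mono_of_mem_nhdsWithin (Icc_mem_nhdsGE_of_mem ht)
  obtain ⟨c₁, d₁⟩ := key γ₁ rfl h₁
  obtain ⟨c₂, d₂⟩ := key γ₂ h₀.symm h₂
  exact ODE_solution_unique (v := fun _ => G) (fun _ => hK) c₁ d₁ c₂ d₂ h₀

/-- The Picard-Lindelöf theorem gives a solution up to time `T` for a cut-off of `F`; by the growth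
bound it stays in the ball where the cut-off has no effect. -/
theorem exists_solution_Icc_of_inner_le [FiniteDimensional ℝ E] {F : E → E} (hF : ContDiff ℝ 1 F)
    {C : ℝ} (hC₀ : 0 ≤ C) (hC : ∀ x, inner ℝ x (F x) ≤ C) (x₀ : E) {T : ℝ} (hT : 0 ≤ T) :
    ∃ γ : ℝ → E, γ 0 = x₀ ∧
      ∀ t ∈ Set.Icc 0 T, HasDerivWithinAt γ (F (γ t)) (Set.Icc 0 T) t := by
  set R : ℝ := √(‖x₀‖ ^ 2 + 2 * C * T) + 1 with hR
  obtain ⟨G, K, L, hK, hL, hGF, hGC⟩ :=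
    exists_lipschitz_cutoff hF hC₀ hC (R := R) (by positivity)
  have hpl : IsPicardLindelof (fun _ : ℝ => G) (⟨0, le_rfl, hT⟩ : Set.Icc 0 T) x₀
      (L * T.toNNReal) 0 L K :=
    { lipschitzOnWith := fun t _ => hK.lipschitzOnWith
      continuousOn := fun x _ => continuousOn_const
      norm_le := fun t _ x _ => hL x
      mul_max_le := by simp [hT] }
  obtain ⟨γ, hγ₀, hγ⟩ := hpl.exists_eq_forall_mem_Icc_hasDerivWithinAt₀
  refine ⟨γ, hγ₀, fun t ht => ?_⟩
  have hn := norm_sq_le_of_inner_le hGC hγ ht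
  have hle : ‖γ t‖ ≤ R := by
    have : ‖γ t‖ ≤ √(‖x₀‖ ^ 2 + 2 * C * T) := by
      apply Real.le_sqrt_of_sq_le
      have := mul_le_mul_of_nonneg_left ht.2 hC₀
      simp only at hγ₀
      rw [hγ₀] at hn
      linarith
    linarith
  rw [← hGF _ hle]
  exact hγ t ht

/-- A `C¹` vector field `F` with `⟪x, F x⟫` bounded above has a forward solution for all times,
from every initial value. -/
theorem exists_solution_Ici_of_inner_le [FiniteDimensional ℝ E] {F : E → E} (hF : ContDiff ℝ 1 F)
    {C : ℝ} (hC : ∀ x, inner ℝ x (F x) ≤ C) (x₀ : E) :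
    ∃ γ : ℝ → E, γ 0 = x₀ ∧
      ∀ t, 0 ≤ t → HasDerivWithinAt γ (F (γ t)) (Set.Ici 0) t := by
  have hC₀ : 0 ≤ C := by simpa using hC 0
  -- glue the solutions `sol N` on `[0, N]`
  choose sol hsol₀ hsol using fun N : ℕ =>
    exists_solution_Icc_of_inner_le hF hC₀ hC x₀ (Nat.cast_nonneg (α := ℝ) N)
  have heq : ∀ {M N : ℕ} {s : ℝ}, 0 ≤ s → s ≤ M → M ≤ N → sol M s = sol N s := by
    intro M N s h0 hM hMN
    exact eqOn_of_inner_le hF hC₀ hC (Nat.cast_le.2 hMN) (hsol M) (hsol N)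
      ((hsol₀ M).trans (hsol₀ N).symm) ⟨h0, hM⟩
  refine ⟨fun t => sol (⌊t⌋₊ + 1) t, hsol₀ _, fun t ht => ?_⟩
  set N := ⌊t⌋₊ + 1 with hN
  have htN : t < N := by simpa [hN] using Nat.lt_floor_add_one t
  have hmem : Set.Icc 0 (N : ℝ) ∈ 𝓝[Set.Ici 0] t := by
    refine mem_nhdsWithin.2 ⟨Set.Iio N, isOpen_Iio, htN, fun s hs => ⟨hs.2, le_of_lt hs.1⟩⟩
  have hev : (fun t => sol (⌊t⌋₊ + 1) t) =ᶠ[𝓝[Set.Ici 0] t] sol N := by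
    refine mem_nhdsWithin.2 ⟨Set.Iio N, isOpen_Iio, htN, fun s hs => ?_⟩
    have h1 : s ≤ ((⌊s⌋₊ + 1 : ℕ) : ℝ) := by simpa using (Nat.lt_floor_add_one s).le
    have h2 : ⌊s⌋₊ + 1 ≤ N := (Nat.floor_lt hs.2).2 hs.1
    exact heq hs.2 h1 h2
  exact (((hsol N t ⟨ht, htN.le⟩).mono_of_mem_nhdsWithin hmem).congr_of_eventuallyEq hev
    (by rfl))

end GlobalExistence

namespace LinearTransfer

/-! ### Euclidean norms of coordinate vectors -/

section Norms

variable {d k m : ℕ}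

theorem euclNorm_nonneg (x : Fin d → ℝ) : 0 ≤ euclNorm x := norm_nonneg _

theorem euclNorm_sq (x : Fin d → ℝ) : euclNorm x ^ 2 = x ⬝ᵥ x := by
  rw [euclNorm, EuclideanSpace.norm_sq_eq]
  simp [dotProduct, sq]

theorem euclNorm_add_le (x y : Fin d → ℝ) : euclNorm (x + y) ≤ euclNorm x + euclNorm y := by
  simpa [euclNorm] using norm_add_le (WithLp.toLp 2 x) (WithLp.toLp 2 y)

theorem euclNorm_sub_le (x y : Fin d → ℝ) : euclNorm (x - y) ≤ euclNorm x + euclNorm y := by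
  simpa [euclNorm] using norm_sub_le (WithLp.toLp 2 x) (WithLp.toLp 2 y)

theorem euclNorm_smul (c : ℝ) (x : Fin d → ℝ) : euclNorm (c • x) = |c| * euclNorm x := by
  simp [euclNorm, norm_smul]

theorem euclNorm_eq_zero {x : Fin d → ℝ} : euclNorm x = 0 ↔ x = 0 := by
  simp [euclNorm]

theorem abs_dotProduct_le (x y : Fin d → ℝ) : |x ⬝ᵥ y| ≤ euclNorm x * euclNorm y := by
  have h := abs_real_inner_le_norm (WithLp.toLp 2 x) (WithLp.toLp 2 y)
  rw [EuclideanSpace.inner_toLp_toLp, star_trivial, dotProduct_comm] at h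
  exact h

theorem continuous_euclNorm : Continuous (euclNorm : (Fin d → ℝ) → ℝ) := by
  unfold euclNorm
  fun_prop

theorem matOpNorm_nonneg (A : Matrix (Fin k) (Fin d) ℝ) : 0 ≤ matOpNorm A := norm_nonneg _

theorem euclNorm_mulVec_le (A : Matrix (Fin k) (Fin d) ℝ) (x : Fin d → ℝ) :
    euclNorm (A *ᵥ x) ≤ matOpNorm A * euclNorm x := by
  have h := (LinearMap.toContinuousLinearMap (Matrix.toEuclideanLin A)).le_opNorm (WithLp.toLp 2 x)
  simpa [euclNorm, matOpNorm] using h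

theorem euclNorm_sq_mulVec (A : Matrix (Fin k) (Fin d) ℝ) (x : Fin d → ℝ) :
    euclNorm (A *ᵥ x) ^ 2 = x ⬝ᵥ (Aᵀ *ᵥ (A *ᵥ x)) := by
  rw [euclNorm_sq, Matrix.dotProduct_mulVec, ← Matrix.mulVec_transpose, dotProduct_comm]

theorem euclNorm_transpose_mulVec_le (A : Matrix (Fin k) (Fin d) ℝ) (x : Fin k → ℝ) :
    euclNorm (Aᵀ *ᵥ x) ≤ matOpNorm A * euclNorm x := by
  have h1 : euclNorm (Aᵀ *ᵥ x) ^ 2 ≤ euclNorm x * (matOpNorm A * euclNorm (Aᵀ *ᵥ x)) := by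
    rw [euclNorm_sq_mulVec, Matrix.transpose_transpose]
    exact (le_abs_self _).trans ((abs_dotProduct_le _ _).trans
      (mul_le_mul_of_nonneg_left (euclNorm_mulVec_le _ _) (euclNorm_nonneg _)))
  rcases (euclNorm_nonneg (Aᵀ *ᵥ x)).eq_or_lt with h | h
  · rw [← h]
    exact mul_nonneg (matOpNorm_nonneg _) (euclNorm_nonneg _)
  · exact le_of_mul_le_mul_right (by nlinarith) h

/-- A matrix with orthonormal columns is an isometry. -/
theorem euclNorm_mulVec_of_transpose_mul {A : Matrix (Fin d) (Fin k) ℝ} (hA : Aᵀ * A = 1)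
    (a : Fin k → ℝ) : euclNorm (A *ᵥ a) = euclNorm a := by
  have : euclNorm (A *ᵥ a) ^ 2 = euclNorm a ^ 2 := by
    rw [euclNorm_sq_mulVec, Matrix.mulVec_mulVec, hA, Matrix.one_mulVec, euclNorm_sq]
  exact (sq_eq_sq₀ (euclNorm_nonneg _) (euclNorm_nonneg _)).1 this

/-- A matrix with orthonormal rows is an isometry when transposed. -/
theorem euclNorm_transpose_mulVec_of_mul {B : Matrix (Fin k) (Fin d) ℝ} (hB : B * Bᵀ = 1)
    (a : Fin k → ℝ) : euclNorm (Bᵀ *ᵥ a) = euclNorm a :=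
  euclNorm_mulVec_of_transpose_mul (by simpa using hB) a

theorem euclNorm_transpose_mulVec_le_of_transpose_mul {F : Matrix (Fin d) (Fin m) ℝ}
    (hF : Fᵀ * F = 1) (x : Fin d → ℝ) : euclNorm (Fᵀ *ᵥ x) ≤ euclNorm x := by
  have h1 : euclNorm (Fᵀ *ᵥ x) ^ 2 ≤ euclNorm x * euclNorm (Fᵀ *ᵥ x) := by
    rw [euclNorm_sq_mulVec, Matrix.transpose_transpose]
    refine (le_abs_self _).trans ((abs_dotProduct_le _ _).trans ?_)
    rw [euclNorm_mulVec_of_transpose_mul hF]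
  nlinarith [euclNorm_nonneg (Fᵀ *ᵥ x), euclNorm_nonneg x]

/-- The residual of the orthogonal projection onto the column space of `F` is a contraction. -/
theorem euclNorm_sub_projection_le {F : Matrix (Fin d) (Fin m) ℝ} (hF : Fᵀ * F = 1)
    (x : Fin d → ℝ) : euclNorm (x - F *ᵥ (Fᵀ *ᵥ x)) ≤ euclNorm x := by
  have h : euclNorm (x - F *ᵥ (Fᵀ *ᵥ x)) ^ 2 = euclNorm x ^ 2 - euclNorm (Fᵀ *ᵥ x) ^ 2 := by
    have h1 : x ⬝ᵥ (F *ᵥ (Fᵀ *ᵥ x)) = euclNorm (Fᵀ *ᵥ x) ^ 2 := by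
      rw [euclNorm_sq_mulVec, Matrix.transpose_transpose]
    have h2 : (F *ᵥ (Fᵀ *ᵥ x)) ⬝ᵥ (F *ᵥ (Fᵀ *ᵥ x)) = euclNorm (Fᵀ *ᵥ x) ^ 2 := by
      rw [← euclNorm_sq, euclNorm_mulVec_of_transpose_mul hF]
    rw [euclNorm_sq, sub_dotProduct, dotProduct_sub, dotProduct_sub, h2,
      dotProduct_comm (F *ᵥ (Fᵀ *ᵥ x)) x, h1, ← euclNorm_sq]
    ring
  nlinarith [euclNorm_nonneg (x - F *ᵥ (Fᵀ *ᵥ x)), euclNorm_nonneg x,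
    sq_nonneg (euclNorm (Fᵀ *ᵥ x))]

theorem euclNorm_orthogonal_mulVec (U : Matrix.orthogonalGroup (Fin k) ℝ) (x : Fin k → ℝ) :
    euclNorm ((U : Matrix (Fin k) (Fin k) ℝ) *ᵥ x) = euclNorm x :=
  euclNorm_mulVec_of_transpose_mul ((Matrix.mem_orthogonalGroup_iff' _ _).1 U.2) x

end Norms

/-! ### The smallest singular value and principal angles -/

section Angles

/-- The last singular value of a linear map bounds the map from below. -/
theorem singularValues_finrank_sub_one_mul_norm_le {E G : Type*}
    [NormedAddCommGroup E] [InnerProductSpace ℝ E] [FiniteDimensional ℝ E]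
    [NormedAddCommGroup G] [InnerProductSpace ℝ G] [FiniteDimensional ℝ G]
    (T : E →ₗ[ℝ] G) (x : E) :
    T.singularValues (Module.finrank ℝ E - 1) * ‖x‖ ≤ ‖T x‖ := by
  set r := Module.finrank ℝ E with hr
  rcases Nat.eq_zero_or_pos r with h0 | hpos
  · have : Subsingleton E := Module.finrank_zero_iff.1 h0
    simp [Subsingleton.elim x 0]
  set σ := T.singularValues (r - 1)
  have hσ : 0 ≤ σ := T.singularValues_nonneg _
  -- expand in an eigenbasis of `T† T`, whose eigenvalues `ev` are at least `σ ^ 2`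
  let b := T.isSymmetric_adjoint_comp_self.eigenvectorBasis hr.symm
  let ev := T.isSymmetric_adjoint_comp_self.eigenvalues hr.symm
  have hev : ∀ i, σ ^ 2 ≤ ev i := by
    intro i
    rw [T.sq_singularValues_of_lt hr.symm (i := r - 1) (by omega)]
    exact T.isSymmetric_adjoint_comp_self.eigenvalues_antitone hr.symm
      (Fin.le_def.2 (by have := i.2; simp only; omega))
  have h1 : ‖T x‖ ^ 2 = ∑ i, ev i * (inner ℝ x (b i)) ^ 2 := by
    rw [← real_inner_self_eq_norm_sq, ← LinearMap.adjoint_inner_right, ← b.sum_inner_mul_inner]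
    refine Finset.sum_congr rfl fun i _ => ?_
    have := T.isSymmetric_adjoint_comp_self.eigenvectorBasis_apply_self_apply hr.symm x i
    rw [OrthonormalBasis.repr_apply_apply, OrthonormalBasis.repr_apply_apply] at this
    simp only [LinearMap.comp_apply] at this
    change inner ℝ (b i) _ = ev i * inner ℝ (b i) x at this
    rw [this, real_inner_comm]
    ring
  have h2 : ‖x‖ ^ 2 = ∑ i, (inner ℝ x (b i)) ^ 2 := by
    rw [← real_inner_self_eq_norm_sq, ← b.sum_inner_mul_inner]
    exact Finset.sum_congr rfl fun i _ => by rw [real_inner_comm x (b i)]; ring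
  refine abs_le_of_sq_le_sq' ?_ (norm_nonneg _) |>.2
  rw [mul_pow, h1, h2, Finset.mul_sum]
  exact Finset.sum_le_sum fun i _ => mul_le_mul_of_nonneg_right (hev i) (sq_nonneg _)

/-- When `dim R ≤ dim S`, projecting a vector of `R` onto `S` shrinks it at most by the factor
`cosMaxAngle R S`. -/
theorem cosMaxAngle_mul_norm_le {d : ℕ} {R S : Submodule ℝ (EuclideanSpace ℝ (Fin d))}
    (h : Module.finrank ℝ R ≤ Module.finrank ℝ S) {x : EuclideanSpace ℝ (Fin d)} (hx : x ∈ R) :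
    cosMaxAngle R S * ‖x‖ ≤ ‖S.starProjection x‖ := by
  have := singularValues_finrank_sub_one_mul_norm_le
    ((S.orthogonalProjectionOnto : EuclideanSpace ℝ (Fin d) →ₗ[ℝ] S) ∘ₗ R.subtype) ⟨x, hx⟩
  rw [cosMaxAngle, min_eq_left h]
  simpa using this

variable {d k m : ℕ}

theorem toLp_transpose_mulVec_mem_rowSpace (B : Matrix (Fin k) (Fin d) ℝ) (a : Fin k → ℝ) :
    WithLp.toLp 2 (Bᵀ *ᵥ a) ∈ rowSpace B := by
  have : WithLp.toLp 2 (Bᵀ *ᵥ a) = ∑ i, a i • WithLp.toLp 2 (B i) := by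
    ext j
    simp [Matrix.mulVec, dotProduct, mul_comm]
  rw [this]
  exact Submodule.sum_mem _ fun i _ =>
    Submodule.smul_mem _ _ (Submodule.subset_span (Set.mem_range_self i))

theorem finrank_rowSpace {B : Matrix (Fin k) (Fin d) ℝ} (hB : B * Bᵀ = 1) :
    Module.finrank ℝ (rowSpace B) = k := by
  have ho : Orthonormal ℝ fun i => WithLp.toLp 2 (B i) := by
    rw [orthonormal_iff_ite]
    intro i j
    have := congrFun (congrFun hB i) j
    rw [Matrix.mul_apply, Matrix.one_apply] at this
    rw [EuclideanSpace.inner_toLp_toLp, star_trivial, dotProduct_comm, ← this]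
    rfl
  rw [rowSpace]
  exact (finrank_span_eq_card ho.linearIndependent).trans (Fintype.card_fin k)

theorem finrank_colSpace {F : Matrix (Fin d) (Fin m) ℝ} (hF : Fᵀ * F = 1) :
    Module.finrank ℝ (colSpace F) = m :=
  finrank_rowSpace (by simpa using hF)

theorem starProjection_colSpace {F : Matrix (Fin d) (Fin m) ℝ} (hF : Fᵀ * F = 1)
    (x : Fin d → ℝ) :
    (colSpace F).starProjection (WithLp.toLp 2 x) = WithLp.toLp 2 (F *ᵥ (Fᵀ *ᵥ x)) := by
  refine Submodule.eq_starProjection_of_mem_of_inner_eq_zero (K := colSpace F) ?_ ?_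
  · exact toLp_transpose_mulVec_mem_rowSpace Fᵀ (Fᵀ *ᵥ x)
  · intro w hw
    refine Submodule.span_induction (p := fun w _ => inner ℝ (WithLp.toLp 2 x -
      WithLp.toLp 2 (F *ᵥ (Fᵀ *ᵥ x))) w = 0) ?_ (by simp) ?_ ?_ hw
    · rintro _ ⟨i, rfl⟩
      rw [← WithLp.toLp_sub, EuclideanSpace.inner_toLp_toLp, star_trivial]
      change (Fᵀ *ᵥ (x - F *ᵥ (Fᵀ *ᵥ x))) i = 0
      rw [Matrix.mulVec_sub, Matrix.mulVec_mulVec _ Fᵀ F, hF, Matrix.one_mulVec, sub_self]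
      rfl
    · intro y z _ _ hy hz
      rw [inner_add_right, hy, hz, add_zero]
    · intro c y _ hy
      rw [inner_smul_right, hy, mul_zero]

theorem cosMaxAngle_mul_euclNorm_le {B : Matrix (Fin k) (Fin d) ℝ} {F : Matrix (Fin d) (Fin m) ℝ}
    (hB : B * Bᵀ = 1) (hF : Fᵀ * F = 1) (hkm : k ≤ m) (a : Fin k → ℝ) :
    cosMaxAngle (rowSpace B) (colSpace F) * euclNorm a ≤ euclNorm (Fᵀ *ᵥ (Bᵀ *ᵥ a)) := by
  have h := cosMaxAngle_mul_norm_le (R := rowSpace B) (S := colSpace F)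
    (by rwa [finrank_rowSpace hB, finrank_colSpace hF]) (toLp_transpose_mulVec_mem_rowSpace B a)
  rw [starProjection_colSpace hF] at h
  change _ * euclNorm (Bᵀ *ᵥ a) ≤ euclNorm (F *ᵥ (Fᵀ *ᵥ (Bᵀ *ᵥ a))) at h
  rwa [euclNorm_transpose_mulVec_of_mul hB, euclNorm_mulVec_of_transpose_mul hF] at h

theorem cosMaxAngle_orthogonal_mul_euclNorm_le {B : Matrix (Fin k) (Fin d) ℝ}
    {F : Matrix (Fin d) (Fin m) ℝ} (hB : B * Bᵀ = 1) (hF : Fᵀ * F = 1) (hkm : m + k ≤ d)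
    (a : Fin k → ℝ) :
    cosMaxAngle (rowSpace B) (colSpace F)ᗮ * euclNorm a ≤
      euclNorm (Bᵀ *ᵥ a - F *ᵥ (Fᵀ *ᵥ (Bᵀ *ᵥ a))) := by
  have hfin := (colSpace F).finrank_add_finrank_orthogonal
  rw [finrank_colSpace hF, finrank_euclideanSpace_fin] at hfin
  have h := cosMaxAngle_mul_norm_le (R := rowSpace B) (S := (colSpace F)ᗮ)
    (by rw [finrank_rowSpace hB]; omega) (toLp_transpose_mulVec_mem_rowSpace B a)
  rw [Submodule.starProjection_orthogonal_val, starProjection_colSpace hF] at h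
  change _ * euclNorm (Bᵀ *ᵥ a) ≤ euclNorm (Bᵀ *ᵥ a - F *ᵥ (Fᵀ *ᵥ (Bᵀ *ᵥ a))) at h
  rwa [euclNorm_transpose_mulVec_of_mul hB] at h

end Angles

/-! ### Gaussian estimates -/

section Gaussian

variable {n d k m : ℕ}

theorem map_dotProduct_pi_gaussianReal (s : ℝ≥0) (b : Fin k → ℝ) :
    (Measure.pi fun _ : Fin k => gaussianReal 0 s).map (fun z => z ⬝ᵥ b) =
      gaussianReal 0 (s * (euclNorm b ^ 2).toNNReal) := by
  have hm : Measurable fun z : Fin k → ℝ => z ⬝ᵥ b := by unfold dotProduct; fun_prop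
  have : IsProbabilityMeasure
      ((Measure.pi fun _ : Fin k => gaussianReal 0 s).map (fun z => z ⬝ᵥ b)) :=
    Measure.isProbabilityMeasure_map hm.aemeasurable
  refine Measure.ext_of_charFun (funext fun t => ?_)
  have hpi := charFun_pi (μ := fun _ : Fin k => gaussianReal 0 s) (WithLp.toLp 2 (t • b))
  rw [charFun_apply, integral_map (by fun_prop) (by fun_prop)] at hpi
  rw [charFun_apply, integral_map (by fun_prop) (by fun_prop)]
  have hin : ∀ z : Fin k → ℝ, inner ℝ (z ⬝ᵥ b) t =
      inner ℝ (WithLp.toLp 2 z) (WithLp.toLp 2 (t • b)) := by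
    intro z
    rw [EuclideanSpace.inner_toLp_toLp, star_trivial, smul_dotProduct, dotProduct_comm b z]
    simp
  simp_rw [hin]
  rw [hpi]
  simp_rw [charFun_gaussianReal]
  rw [← Complex.exp_sum]
  congr 1
  have hb : ((euclNorm b ^ 2).toNNReal : ℝ) = ∑ i, b i ^ 2 := by
    rw [Real.coe_toNNReal _ (sq_nonneg _), euclNorm_sq]
    simp [dotProduct, sq]
  rw [NNReal.coe_mul, hb]
  push_cast
  simp only [Pi.smul_apply, smul_eq_mul]
  rw [Finset.mul_sum, Finset.sum_mul, Finset.sum_div]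
  simp only [Complex.ofReal_mul, mul_zero, zero_mul, zero_sub, Finset.sum_neg_distrib, neg_inj]
  exact Finset.sum_congr rfl fun i _ => by ring

theorem measurable_mulVec_const (F : Matrix (Fin d) (Fin m) ℝ) :
    Measurable fun z : Fin m → ℝ => F *ᵥ z := by
  refine measurable_pi_lambda _ fun i => ?_
  unfold Matrix.mulVec dotProduct
  fun_prop

theorem isProbabilityMeasure_idDistribution (F : Matrix (Fin d) (Fin m) ℝ) :
    IsProbabilityMeasure (idDistribution F) :=
  Measure.isProbabilityMeasure_map (measurable_mulVec_const F).aemeasurable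

theorem map_dotProduct_idDistribution (F : Matrix (Fin d) (Fin m) ℝ) (b : Fin d → ℝ) :
    (idDistribution F).map (fun x => x ⬝ᵥ b) =
      gaussianReal 0 (euclNorm (Fᵀ *ᵥ b) ^ 2).toNNReal := by
  have hm : Measurable fun z : Fin d → ℝ => z ⬝ᵥ b := by unfold dotProduct; fun_prop
  rw [idDistribution, Measure.map_map hm (measurable_mulVec_const F)]
  have : (fun x => x ⬝ᵥ b) ∘ (fun z => F *ᵥ z) = fun z : Fin m → ℝ => z ⬝ᵥ (Fᵀ *ᵥ b) := by
    funext z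
    simp only [Function.comp_apply]
    rw [dotProduct_comm, Matrix.dotProduct_mulVec, ← Matrix.mulVec_transpose, dotProduct_comm]
  rw [this, map_dotProduct_pi_gaussianReal, one_mul]

theorem lintegral_sq_gaussianReal (v : ℝ≥0) :
    ∫⁻ x, ENNReal.ofReal (x ^ 2) ∂gaussianReal 0 v = v := by
  have h : ∫ x, x ^ 2 ∂gaussianReal 0 v = v := by
    have := variance_fun_id_gaussianReal (μ := 0) (v := v)
    rw [variance_eq_integral measurable_id'.aemeasurable] at this
    simpa using this
  have hi : Integrable (fun x : ℝ => x ^ 2) (gaussianReal 0 v) :=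
    (memLp_id_gaussianReal (μ := 0) (v := v) 2).integrable_sq
  rw [← ofReal_integral_eq_lintegral_ofReal hi (ae_of_all _ fun x => sq_nonneg x), h]
  simp

theorem lintegral_exp_neg_mul_sq_gaussianReal_le {v : ℝ≥0} (hv : v ≠ 0) {l : ℝ} (hl : 0 < l) :
    ∫⁻ x, ENNReal.ofReal (Real.exp (-(l / 2) * x ^ 2)) ∂gaussianReal 0 v ≤
      ENNReal.ofReal (√(l * v))⁻¹ := by
  have hv' : (0 : ℝ) < v := by positivity
  rw [gaussianReal_of_var_ne_zero _ hv,
    lintegral_withDensity_eq_lintegral_mul _ (measurable_gaussianPDF 0 v) (by fun_prop)]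
  have hle : ∀ x : ℝ, (gaussianPDF 0 v * fun x => ENNReal.ofReal (Real.exp (-(l / 2) * x ^ 2))) x ≤
      ENNReal.ofReal ((√(2 * Real.pi * v))⁻¹ * Real.exp (-(l / 2) * x ^ 2)) := by
    intro x
    rw [Pi.mul_apply, gaussianPDF, ← ENNReal.ofReal_mul (gaussianPDFReal_nonneg _ _ _)]
    refine ENNReal.ofReal_le_ofReal (mul_le_mul_of_nonneg_right ?_ (Real.exp_nonneg _))
    rw [gaussianPDFReal]
    refine mul_le_of_le_one_right (by positivity) (Real.exp_le_one_iff.2 ?_)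
    exact div_nonpos_of_nonpos_of_nonneg (neg_nonpos.2 (sq_nonneg _)) (by positivity)
  refine (lintegral_mono hle).trans ?_
  rw [← ofReal_integral_eq_lintegral_ofReal
    ((integrable_exp_neg_mul_sq (by positivity)).const_mul _)
    (ae_of_all _ fun x => by positivity), integral_const_mul, integral_gaussian]
  refine ENNReal.ofReal_le_ofReal (le_of_eq ?_)
  rw [← Real.sqrt_inv, ← Real.sqrt_inv, ← Real.sqrt_mul (by positivity)]
  congr 1
  field_simp

/-- The standard bound on a centred Gaussian density away from the origin, uniform in the
variance. -/
theorem gaussianPDFReal_zero_le {v : ℝ≥0} (hv : v ≠ 0) {x : ℝ} (hx : x ≠ 0) :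
    gaussianPDFReal 0 v x ≤ (2 * |x|)⁻¹ := by
  have hv' : (0 : ℝ) < v := by positivity
  have hx' : 0 < |x| := abs_pos.2 hx
  have hA : 2 * |x| * Real.exp (-x ^ 2 / (2 * v)) ≤ √(2 * Real.pi * v) := by
    apply Real.le_sqrt_of_sq_le
    rw [mul_pow, mul_pow, sq_abs, ← Real.exp_nat_mul]
    have h2 : ((2 : ℕ) : ℝ) * (-x ^ 2 / (2 * v)) = -(x ^ 2 / v) := by push_cast; field_simp
    rw [h2]
    have h3 := Real.add_one_le_exp (x ^ 2 / v)
    have h4 : x ^ 2 / v * Real.exp (-(x ^ 2 / v)) ≤ 1 := by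
      rw [Real.exp_neg, ← div_eq_mul_inv, div_le_one (Real.exp_pos _)]
      linarith
    have h5 : (2 : ℝ) ^ 2 * x ^ 2 * Real.exp (-(x ^ 2 / v)) =
        4 * v * (x ^ 2 / v * Real.exp (-(x ^ 2 / v))) := by field_simp; ring
    rw [h5]
    nlinarith [Real.pi_gt_three]
  rw [gaussianPDFReal, sub_zero, le_inv_comm₀ (by positivity) (by positivity)]
  rw [mul_inv, inv_inv, ← div_eq_mul_inv, le_div_iff₀ (Real.exp_pos _)]
  exact hA

/-- Anti-concentration: the square of a centred Gaussian variable, of any variance, is rarely close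
to a given positive number `a ^ 2`. -/
theorem gaussianReal_abs_sq_sub_lt_le (v : ℝ≥0) {a η : ℝ} (ha : 0 < a) (hη : 0 < η)
    (hηa : η ≤ 3 / 4 * a ^ 2) :
    gaussianReal 0 v {y | |y ^ 2 - a ^ 2| < η} ≤ ENNReal.ofReal (4 * η / a ^ 2) := by
  have hlow : ∀ y ∈ {y : ℝ | |y ^ 2 - a ^ 2| < η}, a / 2 < |y| := by
    intro y hy
    have hy' : |y ^ 2 - a ^ 2| < η := hy
    have h1 := (abs_lt.1 hy').1
    have : (a / 2) ^ 2 < |y| ^ 2 := by rw [sq_abs]; nlinarith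
    exact lt_of_pow_lt_pow_left₀ 2 (abs_nonneg y) this
  rcases eq_or_ne v 0 with rfl | hv
  · rw [gaussianReal_zero_var, Measure.dirac_apply' _ (by measurability)]
    rw [Set.indicator_of_notMem]
    · simp
    · intro h
      have := hlow 0 h
      simp at this
      linarith
  · rw [gaussianReal_apply _ hv]
    have hsub : {y : ℝ | |y ^ 2 - a ^ 2| < η} ⊆
        Set.Ioo (a - η / a) (a + η / a) ∪ Set.Ioo (-a - η / a) (-a + η / a) := by
      intro y hy
      have key : |(|y| - a)| < η / a := by
        rw [lt_div_iff₀ ha]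
        have h1 : |y ^ 2 - a ^ 2| = |(|y| - a)| * (|y| + a) := by
          rw [← abs_of_pos (show 0 < |y| + a by positivity), ← abs_mul,
            ← sq_abs y]
          congr 1
          ring
        have h2 : |(|y| - a)| * a ≤ |(|y| - a)| * (|y| + a) :=
          mul_le_mul_of_nonneg_left (by linarith [abs_nonneg y]) (abs_nonneg _)
        exact lt_of_le_of_lt h2 (h1 ▸ hy)
      rw [abs_lt] at key
      rcases le_total 0 y with h | h
      · rw [abs_of_nonneg h] at key
        exact Or.inl ⟨by linarith, by linarith⟩
      · rw [abs_of_nonpos h] at key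
        exact Or.inr ⟨by linarith, by linarith⟩
    calc ∫⁻ x in {y : ℝ | |y ^ 2 - a ^ 2| < η}, gaussianPDF 0 v x
        ≤ ∫⁻ _ in {y : ℝ | |y ^ 2 - a ^ 2| < η}, ENNReal.ofReal a⁻¹ := by
          refine setLIntegral_mono measurable_const fun y hy => ENNReal.ofReal_le_ofReal ?_
          have hy' := hlow y hy
          have hy0 : y ≠ 0 := fun h => by simp [h] at hy'; linarith
          refine (gaussianPDFReal_zero_le hv hy0).trans (inv_anti₀ ha (by linarith))
      _ = ENNReal.ofReal a⁻¹ * volume {y : ℝ | |y ^ 2 - a ^ 2| < η} := by simp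
      _ ≤ ENNReal.ofReal a⁻¹ * ENNReal.ofReal (4 * (η / a)) := by
          gcongr
          refine (measure_mono hsub).trans ((measure_union_le _ _).trans ?_)
          rw [Real.volume_Ioo, Real.volume_Ioo, ← ENNReal.ofReal_add (by ring_nf; positivity)
            (by ring_nf; positivity)]
          exact ENNReal.ofReal_le_ofReal (by linarith)
      _ = ENNReal.ofReal (4 * η / a ^ 2) := by
          rw [← ENNReal.ofReal_mul (by positivity)]
          congr 1
          field_simp

theorem lintegral_idDistribution_comp_dotProduct (F : Matrix (Fin d) (Fin m) ℝ) (b : Fin d → ℝ)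
    {f : ℝ → ENNReal} (hf : Measurable f) :
    ∫⁻ x, f (x ⬝ᵥ b) ∂idDistribution F =
      ∫⁻ y, f y ∂gaussianReal 0 (euclNorm (Fᵀ *ᵥ b) ^ 2).toNNReal := by
  rw [← map_dotProduct_idDistribution, lintegral_map hf (by unfold dotProduct; fun_prop)]

theorem lintegral_sum_sq_dotProduct (F : Matrix (Fin d) (Fin m) ℝ) (b : Fin d → ℝ) :
    ∫⁻ X : Fin n → Fin d → ℝ, ENNReal.ofReal (∑ i, (X i ⬝ᵥ b) ^ 2)
      ∂(Measure.pi fun _ : Fin n => idDistribution F) =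
      ENNReal.ofReal (n * euclNorm (Fᵀ *ᵥ b) ^ 2) := by
  have := isProbabilityMeasure_idDistribution F
  have h : ∀ i : Fin n, Measurable fun X : Fin n → Fin d → ℝ =>
      ENNReal.ofReal ((X i ⬝ᵥ b) ^ 2) := by intro i; unfold dotProduct; fun_prop
  simp_rw [ENNReal.ofReal_sum_of_nonneg fun i _ => sq_nonneg _]
  rw [lintegral_finsetSum _ fun i _ => h i]
  have hi : ∀ i : Fin n, ∫⁻ X : Fin n → Fin d → ℝ, ENNReal.ofReal ((X i ⬝ᵥ b) ^ 2)
      ∂(Measure.pi fun _ : Fin n => idDistribution F) =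
      ENNReal.ofReal (euclNorm (Fᵀ *ᵥ b) ^ 2) := by
    intro i
    rw [(measurePreserving_eval (fun _ : Fin n => idDistribution F) i).lintegral_comp
      (f := fun x => ENNReal.ofReal ((x ⬝ᵥ b) ^ 2)) (by unfold dotProduct; fun_prop),
      lintegral_idDistribution_comp_dotProduct F b (f := fun y => ENNReal.ofReal (y ^ 2))
        (by fun_prop), lintegral_sq_gaussianReal]
    rfl
  simp [hi, ENNReal.ofReal_mul]

theorem lintegral_exp_neg_sum_sq_dotProduct_le (F : Matrix (Fin d) (Fin m) ℝ) {b : Fin d → ℝ}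
    (hb : Fᵀ *ᵥ b ≠ 0) {l : ℝ} (hl : 0 < l) :
    ∫⁻ X : Fin n → Fin d → ℝ, ENNReal.ofReal (Real.exp (-(l / 2) * ∑ i, (X i ⬝ᵥ b) ^ 2))
      ∂(Measure.pi fun _ : Fin n => idDistribution F) ≤
      ENNReal.ofReal (√l * euclNorm (Fᵀ *ᵥ b))⁻¹ ^ n := by
  have := isProbabilityMeasure_idDistribution F
  have hpos : 0 < euclNorm (Fᵀ *ᵥ b) :=
    (euclNorm_nonneg _).lt_of_ne' fun h => hb (euclNorm_eq_zero.1 h)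
  have hm : Measurable fun x : Fin d → ℝ =>
      ENNReal.ofReal (Real.exp (-(l / 2) * (x ⬝ᵥ b) ^ 2)) := by unfold dotProduct; fun_prop
  simp_rw [Finset.mul_sum, Real.exp_sum,
    ENNReal.ofReal_prod_of_nonneg fun i _ => Real.exp_nonneg _]
  rw [lintegral_prod_eq_prod_lintegral_of_indepFun Finset.univ
    (fun i (X : Fin n → Fin d → ℝ) => ENNReal.ofReal (Real.exp (-(l / 2) * (X i ⬝ᵥ b) ^ 2)))
    (iIndepFun_pi fun _ => hm.aemeasurable) fun i => hm.comp (measurable_pi_apply i)]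
  refine (Finset.prod_le_pow_card _ _ (ENNReal.ofReal (√l * euclNorm (Fᵀ *ᵥ b))⁻¹)
    fun i _ => ?_).trans (by simp)
  rw [(measurePreserving_eval (fun _ : Fin n => idDistribution F) i).lintegral_comp
      (f := fun x => ENNReal.ofReal (Real.exp (-(l / 2) * (x ⬝ᵥ b) ^ 2))) hm,
      lintegral_idDistribution_comp_dotProduct F b
        (f := fun y => ENNReal.ofReal (Real.exp (-(l / 2) * y ^ 2))) (by fun_prop)]
  refine (lintegral_exp_neg_mul_sq_gaussianReal_le
    (Real.toNNReal_pos.2 (pow_pos hpos 2)).ne' hl).trans (le_of_eq ?_)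
  rw [Real.coe_toNNReal _ (sq_nonneg _), Real.sqrt_mul hl.le, Real.sqrt_sq hpos.le]

end Gaussian

/-! ### The smallest singular value of a Gaussian matrix -/

section SmallestSingularValue

variable {n d k m : ℕ}

/-- Markov's inequality, solved for the threshold. -/
theorem measure_ofReal_div_le_le {Ω : Type*} [MeasurableSpace Ω] {μ : Measure Ω} {f : Ω → ENNReal}
    (hf : AEMeasurable f μ) {J p : ℝ} (hJ : 0 < J) (hp : 0 < p)
    (h : ∫⁻ x, f x ∂μ ≤ ENNReal.ofReal J) :
    μ {x | ENNReal.ofReal (J / p) ≤ f x} ≤ ENNReal.ofReal p := by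
  have hJp : 0 < J / p := div_pos hJ hp
  have h1 := (mul_meas_ge_le_lintegral₀ hf (ENNReal.ofReal (J / p))).trans h
  have h2 : ENNReal.ofReal J = ENNReal.ofReal (J / p) * ENNReal.ofReal p := by
    rw [← ENNReal.ofReal_mul hJp.le, div_mul_cancel₀ _ hp.ne']
  rw [h2] at h1
  exact (ENNReal.mul_le_mul_iff_right (ENNReal.ofReal_pos.2 hJp).ne' ENNReal.ofReal_ne_top).1 h1

theorem euclNorm_sq_mulVec_eq_sum (X : Matrix (Fin n) (Fin d) ℝ) (b : Fin d → ℝ) :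
    euclNorm (X *ᵥ b) ^ 2 = ∑ i, (X i ⬝ᵥ b) ^ 2 := by
  rw [euclNorm_sq, dotProduct]
  exact Finset.sum_congr rfl fun i _ => (sq _).symm

/-- The Gaussian weight of the sample, averaged over an annulus of directions `a`. It is large as
soon as the sample nearly annihilates one unit vector. -/
noncomputable def annulusWeight (l : ℝ) (B : Matrix (Fin k) (Fin d) ℝ) (X : Fin n → Fin d → ℝ) :
    ENNReal :=
  ∫⁻ a in Metric.ball (0 : EuclideanSpace ℝ (Fin k)) 2 \ Metric.ball 0 (1 / 2),
    ENNReal.ofReal (Real.exp (-(l / 2) * ∑ i, (X i ⬝ᵥ (Bᵀ *ᵥ a.ofLp)) ^ 2))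

theorem continuous_weight (l : ℝ) (B : Matrix (Fin k) (Fin d) ℝ) :
    Continuous fun p : (Fin n → Fin d → ℝ) × EuclideanSpace ℝ (Fin k) =>
      Real.exp (-(l / 2) * ∑ i, (p.1 i ⬝ᵥ (Bᵀ *ᵥ p.2.ofLp)) ^ 2) := by
  unfold Matrix.mulVec dotProduct
  fun_prop

theorem measurable_annulusWeight (l : ℝ) (B : Matrix (Fin k) (Fin d) ℝ) :
    Measurable (annulusWeight (n := n) l B) :=
  Measurable.lintegral_prod_right'
    (f := fun p : (Fin n → Fin d → ℝ) × EuclideanSpace ℝ (Fin k) =>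
      ENNReal.ofReal (Real.exp (-(l / 2) * ∑ i, (p.1 i ⬝ᵥ (Bᵀ *ᵥ p.2.ofLp)) ^ 2)))
    (continuous_weight l B).measurable.ennreal_ofReal

theorem lintegral_annulusWeight_le (F : Matrix (Fin d) (Fin m) ℝ) (B : Matrix (Fin k) (Fin d) ℝ)
    [Nonempty (Fin k)] {q l : ℝ} (hq : 0 < q) (hl : 0 < l)
    (hlow : ∀ a, q * euclNorm a ≤ euclNorm (Fᵀ *ᵥ (Bᵀ *ᵥ a))) :
    ∫⁻ X, annulusWeight l B X ∂(Measure.pi fun _ : Fin n => idDistribution F) ≤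
      ENNReal.ofReal (2 ^ k * (volume (Metric.ball (0 : EuclideanSpace ℝ (Fin k)) 1)).toReal *
        (√l * (q / 2))⁻¹ ^ n) := by
  have := isProbabilityMeasure_idDistribution F
  unfold annulusWeight
  rw [lintegral_lintegral_swap (continuous_weight l B).measurable.ennreal_ofReal.aemeasurable]
  have hms : MeasurableSet
      (Metric.ball (0 : EuclideanSpace ℝ (Fin k)) 2 \ Metric.ball 0 (1 / 2)) :=
    measurableSet_ball.diff measurableSet_ball
  calc _ ≤ ∫⁻ _ in Metric.ball (0 : EuclideanSpace ℝ (Fin k)) 2 \ Metric.ball 0 (1 / 2),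
        ENNReal.ofReal ((√l * (q / 2))⁻¹ ^ n) := by
        refine setLIntegral_mono measurable_const fun a ha => ?_
        have hnorm : 1 / 2 ≤ euclNorm a.ofLp := by
          have h := ha.2
          rw [mem_ball_zero_iff, not_lt] at h
          exact h
        have hlow' : q / 2 ≤ euclNorm (Fᵀ *ᵥ (Bᵀ *ᵥ a.ofLp)) :=
          le_trans (by nlinarith) (hlow a.ofLp)
        have hne : Fᵀ *ᵥ (Bᵀ *ᵥ a.ofLp) ≠ 0 := by
          intro h
          rw [h, euclNorm_eq_zero.2 rfl] at hlow'
          linarith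
        refine (lintegral_exp_neg_sum_sq_dotProduct_le F hne hl).trans ?_
        rw [ENNReal.ofReal_pow (by positivity)]
        gcongr
    _ = ENNReal.ofReal ((√l * (q / 2))⁻¹ ^ n) *
          volume (Metric.ball (0 : EuclideanSpace ℝ (Fin k)) 2 \ Metric.ball 0 (1 / 2)) := by
        rw [setLIntegral_const]
    _ ≤ ENNReal.ofReal ((√l * (q / 2))⁻¹ ^ n) *
          volume (Metric.ball (0 : EuclideanSpace ℝ (Fin k)) 2) := by
        gcongr
        exact Set.sdiff_subset
    _ = _ := by
        rw [Measure.addHaar_ball _ _ (by norm_num), finrank_euclideanSpace_fin,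
          ← ENNReal.ofReal_toReal (measure_ball_lt_top (μ := volume)
            (x := (0 : EuclideanSpace ℝ (Fin k))) (r := 1)).ne,
          ← ENNReal.ofReal_mul (by positivity), ← ENNReal.ofReal_mul (by positivity),
          ENNReal.toReal_ofReal (by positivity)]
        congr 1
        ring

/-- If the sample sends a unit vector `a` to a vector shorter than `τ`, then it sends every vector
of a ball around `a` to one shorter than `2 τ`, so that the averaged weight is not small. -/
theorem le_annulusWeight_of_euclNorm_lt [Nonempty (Fin k)] {l τ M : ℝ} (hl : 0 < l) (hτ : 0 < τ)
    (hM : 0 < M) (hτM : τ / M ≤ 1 / 2) (B : Matrix (Fin k) (Fin d) ℝ)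
    (X : Matrix (Fin n) (Fin d) ℝ) (hX : ∀ h, euclNorm (X *ᵥ (Bᵀ *ᵥ h)) ≤ M * euclNorm h)
    {a : Fin k → ℝ} (ha : euclNorm a = 1) (haX : euclNorm (X *ᵥ (Bᵀ *ᵥ a)) < τ) :
    ENNReal.ofReal ((τ / M) ^ k * (volume (Metric.ball (0 : EuclideanSpace ℝ (Fin k)) 1)).toReal *
      Real.exp (-(2 * l * τ ^ 2))) ≤ annulusWeight l B X := by
  have hr : 0 < τ / M := div_pos hτ hM
  have hsub : Metric.ball (WithLp.toLp 2 a) (τ / M) ⊆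
      Metric.ball (0 : EuclideanSpace ℝ (Fin k)) 2 \ Metric.ball 0 (1 / 2) := by
    intro b hb
    rw [mem_ball_iff_norm] at hb
    have h1 : ‖WithLp.toLp 2 a‖ = 1 := ha
    have h2 := norm_le_norm_add_norm_sub (WithLp.toLp 2 a) b
    have h3 := norm_sub_norm_le b (WithLp.toLp 2 a)
    rw [← norm_sub_rev] at h2
    constructor
    · rw [mem_ball_zero_iff]; linarith
    · rw [mem_ball_zero_iff, not_lt]
      have h4 := norm_sub_norm_le (WithLp.toLp 2 a) b
      rw [norm_sub_rev] at h4
      linarith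
  calc _ = ∫⁻ _ in Metric.ball (WithLp.toLp 2 a : EuclideanSpace ℝ (Fin k)) (τ / M),
        ENNReal.ofReal (Real.exp (-(2 * l * τ ^ 2))) := by
        rw [setLIntegral_const, Measure.addHaar_ball _ _ hr.le, finrank_euclideanSpace_fin,
          ENNReal.ofReal_mul (by positivity), ENNReal.ofReal_mul (by positivity),
          ENNReal.ofReal_toReal measure_ball_lt_top.ne]
        ring
    _ ≤ ∫⁻ b in Metric.ball (WithLp.toLp 2 a : EuclideanSpace ℝ (Fin k)) (τ / M),
        ENNReal.ofReal (Real.exp (-(l / 2) * ∑ i, (X i ⬝ᵥ (Bᵀ *ᵥ b.ofLp)) ^ 2)) := by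
        refine setLIntegral_mono' measurableSet_ball fun b hb => ?_
        refine ENNReal.ofReal_le_ofReal (Real.exp_le_exp.2 ?_)
        rw [← euclNorm_sq_mulVec_eq_sum]
        have hbn : euclNorm (b.ofLp - a) < τ / M := mem_ball_iff_norm.1 hb
        have h1 : euclNorm (X *ᵥ (Bᵀ *ᵥ b.ofLp)) ≤ 2 * τ := by
          have h2 : X *ᵥ (Bᵀ *ᵥ b.ofLp) = X *ᵥ (Bᵀ *ᵥ a) + X *ᵥ (Bᵀ *ᵥ (b.ofLp - a)) := by
            rw [← Matrix.mulVec_add, ← Matrix.mulVec_add, add_sub_cancel]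
          rw [h2]
          refine (euclNorm_add_le _ _).trans ?_
          have h3 : M * euclNorm (b.ofLp - a) ≤ M * (τ / M) := by gcongr
          rw [mul_div_cancel₀ _ hM.ne'] at h3
          linarith [hX (b.ofLp - a)]
        have h4 := pow_le_pow_left₀ (euclNorm_nonneg _) h1 2
        nlinarith
    _ ≤ _ := lintegral_mono_set hsub

theorem euclNorm_mulVec_transpose_mulVec_le (B : Matrix (Fin k) (Fin d) ℝ)
    (X : Matrix (Fin n) (Fin d) ℝ) (h : Fin k → ℝ) :
    euclNorm (X *ᵥ (Bᵀ *ᵥ h)) ^ 2 ≤ (∑ j, ∑ i, (X i ⬝ᵥ B j) ^ 2) * euclNorm h ^ 2 := by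
  rw [euclNorm_sq_mulVec_eq_sum, Finset.sum_comm, Finset.sum_mul]
  refine Finset.sum_le_sum fun i _ => ?_
  have h1 : X i ⬝ᵥ (Bᵀ *ᵥ h) = (B *ᵥ X i) ⬝ᵥ h := by
    rw [Matrix.dotProduct_mulVec, Matrix.vecMul_transpose]
  have h2 : ∑ j, (X i ⬝ᵥ B j) ^ 2 = euclNorm (B *ᵥ X i) ^ 2 := by
    rw [euclNorm_sq_mulVec_eq_sum]
    exact Finset.sum_congr rfl fun j _ => by rw [dotProduct_comm]
  rw [h1, h2, ← mul_pow, ← sq_abs]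
  exact pow_le_pow_left₀ (abs_nonneg _) (abs_dotProduct_le _ _) 2

theorem lintegral_sum_sum_sq_dotProduct_le (F : Matrix (Fin d) (Fin m) ℝ)
    (B : Matrix (Fin k) (Fin d) ℝ) (hup : ∀ a, euclNorm (Fᵀ *ᵥ (Bᵀ *ᵥ a)) ≤ euclNorm a) :
    ∫⁻ X : Fin n → Fin d → ℝ, ENNReal.ofReal (∑ j, ∑ i, (X i ⬝ᵥ B j) ^ 2)
      ∂(Measure.pi fun _ : Fin n => idDistribution F) ≤ ENNReal.ofReal (n * k) := by
  have hm : ∀ j : Fin k, Measurable fun X : Fin n → Fin d → ℝ =>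
      ENNReal.ofReal (∑ i, (X i ⬝ᵥ B j) ^ 2) := by intro j; unfold dotProduct; fun_prop
  simp_rw [ENNReal.ofReal_sum_of_nonneg
    fun (j : Fin k) _ => Finset.sum_nonneg fun i _ => sq_nonneg _]
  rw [lintegral_finsetSum _ fun j _ => hm j]
  have hj : ∀ j : Fin k, ∫⁻ X : Fin n → Fin d → ℝ, ENNReal.ofReal (∑ i, (X i ⬝ᵥ B j) ^ 2)
      ∂(Measure.pi fun _ : Fin n => idDistribution F) ≤ ENNReal.ofReal n := by
    intro j
    rw [lintegral_sum_sq_dotProduct]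
    refine ENNReal.ofReal_le_ofReal (mul_le_of_le_one_right (Nat.cast_nonneg n) ?_)
    have h1 := hup (Pi.single j 1)
    have h2 : Bᵀ *ᵥ Pi.single j 1 = B j := by
      rw [Matrix.mulVec_single_one]
      rfl
    have h3 : euclNorm (Pi.single j (1 : ℝ)) = 1 := by
      have : euclNorm (Pi.single j (1 : ℝ)) ^ 2 = 1 := by rw [euclNorm_sq]; simp
      exact (pow_eq_one_iff_of_nonneg (euclNorm_nonneg _) two_ne_zero).1 this
    rw [h2, h3] at h1
    exact pow_le_one₀ (euclNorm_nonneg _) h1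
  refine (Finset.sum_le_sum fun j _ => hj j).trans (le_of_eq ?_)
  rw [Finset.sum_const, Finset.card_univ, Fintype.card_fin, nsmul_eq_mul, mul_comm,
    ENNReal.ofReal_mul (Nat.cast_nonneg n), ENNReal.ofReal_natCast k]

/-- The numerical inequality behind the volume argument: `y ^ n` beats the ratio of the volumes of
the annulus and of the small ball, because `5 k ≤ n`. -/
theorem volume_ratio_le {q δ : ℝ} (hk : 1 ≤ k) (hn : 5 * k ≤ n) (hq : 0 < q) (hq₁ : q ≤ 1)
    (hδ : 0 < δ) (hδ₁ : δ ≤ 1) (hnδ : 10 * Real.log (1 / δ) ≤ n) :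
    2 ^ k * (25 * √k / (q * √δ))⁻¹ ^ n / (δ / 8) ≤
      (q ^ 2 * δ / (300 * k)) ^ k * Real.exp (-(n / 2)) := by
  have hk' : (1 : ℝ) ≤ k := by exact_mod_cast hk
  have hn' : (5 : ℝ) * k ≤ n := by exact_mod_cast hn
  set y : ℝ := 25 * √k / (q * √δ) with hy
  have hsδ : 0 < √δ := Real.sqrt_pos.2 hδ
  have hsδ1 : √δ ≤ 1 := Real.sqrt_le_one.2 hδ₁
  have hsk : 1 ≤ √(k : ℝ) := Real.one_le_sqrt.2 hk'
  have hy0 : 0 < y := by positivity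
  have hy2 : y ^ 2 = 625 * k / (q ^ 2 * δ) := by
    rw [hy, div_pow, mul_pow, mul_pow, Real.sq_sqrt (by positivity), Real.sq_sqrt hδ.le]
    norm_num
  have hye : Real.exp 2 ≤ y := by
    have h1 : Real.exp 2 ≤ 25 := by
      have := Real.exp_one_lt_d9
      have h2 : Real.exp 2 = Real.exp 1 ^ 2 := by rw [← Real.exp_nat_mul]; norm_num
      rw [h2]
      nlinarith [Real.exp_pos 1]
    refine h1.trans ?_
    rw [hy, le_div_iff₀ (by positivity)]
    have : q * √δ ≤ 1 := mul_le_one₀ hq₁ hsδ.le hsδ1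
    nlinarith
  have h1δ : 1 / δ ≤ Real.exp (n / 10) := by
    rw [← Real.log_le_iff_le_exp (by positivity)]
    linarith
  have h8 : (8 : ℝ) ≤ Real.exp (n / 2) := by
    have h1 : (2.5 : ℝ) ≤ n / 2 := by linarith
    have h2 : Real.exp 2.5 ≤ Real.exp (n / 2) := Real.exp_le_exp.2 h1
    have h3 : (8 : ℝ) ≤ Real.exp 2.5 := by
      have h4 : Real.exp 2.5 ^ 2 = Real.exp 1 ^ 5 := by
        rw [← Real.exp_nat_mul, ← Real.exp_nat_mul]; norm_num
      have h5 : (2.7 : ℝ) ^ 5 ≤ Real.exp 1 ^ 5 :=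
        pow_le_pow_left₀ (by norm_num) (by linarith [Real.exp_one_gt_d9]) 5
      nlinarith [Real.exp_pos 2.5]
    linarith
  -- the ball radius is at least `2 / y ^ 2`
  have hr : 2 * (y ^ 2)⁻¹ ≤ q ^ 2 * δ / (300 * k) := by
    rw [hy2, inv_div, ← mul_div_assoc, div_le_div_iff₀ (by positivity) (by positivity)]
    have : 0 < q ^ 2 * δ * k := by positivity
    nlinarith
  have hpow : Real.exp (11 / 10 * n) ≤ y ^ (n - 2 * k) := by
    have hsub : ((n - 2 * k : ℕ) : ℝ) = n - 2 * k := by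
      rw [Nat.cast_sub (by omega)]; push_cast; ring
    calc Real.exp (11 / 10 * n) ≤ Real.exp (((n - 2 * k : ℕ) : ℝ) * 2) :=
          Real.exp_le_exp.2 (by rw [hsub]; linarith)
      _ = Real.exp 2 ^ (n - 2 * k) := Real.exp_nat_mul _ _
      _ ≤ y ^ (n - 2 * k) := pow_le_pow_left₀ (Real.exp_nonneg _) hye _
  have hexp : 8 * (1 / δ) * Real.exp (n / 2) ≤ y ^ (n - 2 * k) := by
    refine le_trans ?_ hpow
    calc 8 * (1 / δ) * Real.exp (n / 2)
        ≤ Real.exp (n / 2) * Real.exp (n / 10) * Real.exp (n / 2) := by gcongr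
      _ = Real.exp (11 / 10 * n) := by rw [← Real.exp_add, ← Real.exp_add]; congr 1; ring
  have hsplit : y ^ n = y ^ (n - 2 * k) * (y ^ 2) ^ k := by
    rw [← pow_mul, ← pow_add]; congr 1; omega
  calc 2 ^ k * y⁻¹ ^ n / (δ / 8) = (8 * (1 / δ)) * 2 ^ k * (y ^ n)⁻¹ := by
        rw [inv_pow]; field_simp
    _ = (8 * (1 / δ) * Real.exp (n / 2)) * (y ^ (n - 2 * k))⁻¹ * (2 * (y ^ 2)⁻¹) ^ k *
          Real.exp (-(n / 2)) := by
        rw [hsplit, mul_inv, mul_pow, inv_pow, Real.exp_neg]; field_simp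
    _ ≤ 1 * (q ^ 2 * δ / (300 * k)) ^ k * Real.exp (-(n / 2)) := by
        gcongr
        rw [← div_eq_mul_inv]
        exact (div_le_one (by positivity)).2 hexp
    _ = _ := by rw [one_mul]

/-- With high probability the sample is bounded from below on the `k`-dimensional space of features,
at the scale `√(n δ / k)`. -/
theorem measure_exists_euclNorm_lt_le (F : Matrix (Fin d) (Fin m) ℝ)
    (B : Matrix (Fin k) (Fin d) ℝ) {q δ : ℝ} (hk : 1 ≤ k) (hn : 5 * k ≤ n) (hq : 0 < q)
    (hq₁ : q ≤ 1) (hδ : 0 < δ) (hδ₁ : δ ≤ 1) (hnδ : 10 * Real.log (1 / δ) ≤ n)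
    (hlow : ∀ a, q * euclNorm a ≤ euclNorm (Fᵀ *ᵥ (Bᵀ *ᵥ a)))
    (hup : ∀ a, euclNorm (Fᵀ *ᵥ (Bᵀ *ᵥ a)) ≤ euclNorm a) :
    (Measure.pi fun _ : Fin n => idDistribution F) {X | ¬ ∀ a,
      q ^ 2 * √(n * δ / k) / 100 * euclNorm a ≤ euclNorm (Matrix.of X *ᵥ (Bᵀ *ᵥ a))} ≤
      ENNReal.ofReal (δ / 4) := by
  have hne : Nonempty (Fin k) := ⟨⟨0, hk⟩⟩
  have hk' : (1 : ℝ) ≤ k := by exact_mod_cast hk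
  have hn' : (5 : ℝ) * k ≤ n := by exact_mod_cast hn
  have hn0 : (0 : ℝ) < n := by linarith
  have hk0 : (0 : ℝ) < k := by linarith
  -- `M` bounds the Frobenius norm of the sample on the features, whose square has mean at most
  -- `n k`, outside an event of probability `δ / 8` (with `9` rounded up from `8`); `l` is such that
  -- the weight at a vector shorter than `2 τ` is at least `exp (-(n / 2))`
  set τ : ℝ := q ^ 2 * √(n * δ / k) / 100 with hτ
  set M : ℝ := 3 * √(n * k / δ) with hM
  set l : ℝ := 2500 * k / (q ^ 4 * δ) with hl
  set V : ℝ := (volume (Metric.ball (0 : EuclideanSpace ℝ (Fin k)) 1)).toReal with hV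
  have hV0 : 0 < V := ENNReal.toReal_pos
    (Metric.measure_ball_pos volume _ one_pos).ne' measure_ball_lt_top.ne
  have hτ0 : 0 < τ := by positivity
  have hM0 : 0 < M := by positivity
  have hl0 : 0 < l := by positivity
  have hτM : τ / M = q ^ 2 * δ / (300 * k) := by
    have h1 : √(n * δ / k) = √(n * k / δ) * (δ / k) := by
      rw [Real.sqrt_eq_iff_mul_self_eq (by positivity) (by positivity)]
      rw [mul_mul_mul_comm, Real.mul_self_sqrt (by positivity)]
      field_simp
    rw [hτ, hM, h1]
    field_simp
    norm_num
  have hτM' : τ / M ≤ 1 / 2 := by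
    rw [hτM, div_le_div_iff₀ (by positivity) (by norm_num)]
    have : q ^ 2 * δ ≤ 1 := mul_le_one₀ (pow_le_one₀ hq.le hq₁) hδ.le hδ₁
    linarith
  have hlτ : 2 * l * τ ^ 2 = n / 2 := by
    rw [hl, hτ, div_pow, mul_pow, Real.sq_sqrt (by positivity)]
    field_simp
    norm_num
  have hly : √l * (q / 2) = 25 * √k / (q * √δ) := by
    have h1 : √l = 50 * √k / (q ^ 2 * √δ) := by
      rw [Real.sqrt_eq_iff_mul_self_eq (by positivity) (by positivity), div_mul_div_comm,
        mul_mul_mul_comm, Real.mul_self_sqrt hk0.le, mul_mul_mul_comm, Real.mul_self_sqrt hδ.le, hl]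
      ring_nf
    rw [h1]
    field_simp
    norm_num
  have hE := lintegral_annulusWeight_le (n := n) F B hq hl0 hlow
  rw [← hV, hly] at hE
  have hP1 := measure_ofReal_div_le_le (measurable_annulusWeight l B).aemeasurable
    (by positivity) (show 0 < δ / 8 by positivity) hE
  have hmF : Measurable fun X : Fin n → Fin d → ℝ =>
      ENNReal.ofReal (∑ j, ∑ i, (X i ⬝ᵥ B j) ^ 2) := by unfold dotProduct; fun_prop
  have hP2 := measure_ofReal_div_le_le hmF.aemeasurable (by positivity)
    (show 0 < δ / 8 by positivity) (lintegral_sum_sum_sq_dotProduct_le (n := n) F B hup)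
  have hδ4 : ENNReal.ofReal (δ / 4) = ENNReal.ofReal (δ / 8) + ENNReal.ofReal (δ / 8) := by
    rw [← ENNReal.ofReal_add (by positivity) (by positivity)]; congr 1; ring
  rw [hδ4]
  refine le_trans (measure_mono fun X hX => ?_)
    ((measure_union_le _ _).trans (add_le_add hP1 hP2))
  by_contra hcon
  rw [Set.mem_union, not_or] at hcon
  obtain ⟨hc1, hc2⟩ := hcon
  simp only [Set.mem_ofPred_eq, not_le, not_forall] at hX hc1 hc2
  obtain ⟨a, ha⟩ := hX
  have ha0 : 0 < euclNorm a := by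
    refine (euclNorm_nonneg a).lt_of_ne' fun h => ?_
    rw [h, mul_zero] at ha
    exact absurd ha (not_lt.2 (euclNorm_nonneg _))
  have hfro : ∑ j, ∑ i, (X i ⬝ᵥ B j) ^ 2 ≤ M ^ 2 := by
    have h1 := (ENNReal.ofReal_lt_ofReal_iff_of_nonneg
      (Finset.sum_nonneg fun j _ => Finset.sum_nonneg fun i _ => sq_nonneg _)).1 hc2
    refine h1.le.trans ?_
    rw [hM, mul_pow, Real.sq_sqrt (by positivity), div_le_iff₀ (by positivity)]
    field_simp
    norm_num
  have hXM : ∀ h, euclNorm (Matrix.of X *ᵥ (Bᵀ *ᵥ h)) ≤ M * euclNorm h := by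
    intro h
    refine abs_le_of_sq_le_sq' ?_ (mul_nonneg hM0.le (euclNorm_nonneg _)) |>.2
    rw [mul_pow]
    exact (euclNorm_mulVec_transpose_mulVec_le B (Matrix.of X) h).trans
      (mul_le_mul_of_nonneg_right hfro (sq_nonneg _))
  have hbig := le_annulusWeight_of_euclNorm_lt hl0 hτ0 hM0 hτM' B (Matrix.of X) hXM
    (a := (euclNorm a)⁻¹ • a)
    (by rw [euclNorm_smul, abs_of_pos (inv_pos.2 ha0), inv_mul_cancel₀ ha0.ne'])
    (by
      rw [Matrix.mulVec_smul, Matrix.mulVec_smul, euclNorm_smul, abs_of_pos (inv_pos.2 ha0),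
        inv_mul_lt_iff₀ ha0, mul_comm]
      exact ha)
  refine absurd (hbig.trans_lt hc1) (not_lt.2 (ENNReal.ofReal_le_ofReal ?_))
  rw [hlτ, hτM, ← hV]
  have hfin := mul_le_mul_of_nonneg_left (volume_ratio_le hk hn hq hq₁ hδ hδ₁ hnδ) hV0.le
  calc _ = V * (2 ^ k * (25 * √k / (q * √δ))⁻¹ ^ n / (δ / 8)) := by ring
    _ ≤ _ := hfin
    _ = _ := by ring

end SmallestSingularValue

/-! ### The gradients of the training loss -/

section Gradients

variable {n d k : ℕ}

theorem predict_eq_dotProduct (v : Fin k → ℝ) (B : Matrix (Fin k) (Fin d) ℝ) (x : Fin d → ℝ) :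
    predict v B x = x ⬝ᵥ (Bᵀ *ᵥ v) := by
  rw [predict, Matrix.dotProduct_mulVec, ← Matrix.mulVec_transpose, dotProduct_comm]

theorem mulVec_transpose_mulVec_apply (X : Matrix (Fin n) (Fin d) ℝ)
    (B : Matrix (Fin k) (Fin d) ℝ) (v : Fin k → ℝ) (j : Fin n) :
    (X *ᵥ (Bᵀ *ᵥ v)) j = predict v B (X j) := (predict_eq_dotProduct v B (X j)).symm

theorem deriv_sum_sq_add_mul (r c : Fin n → ℝ) :
    deriv (fun h : ℝ => ∑ j, (r j + h * c j) ^ 2) 0 = 2 * ∑ j, r j * c j := by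
  have h : HasDerivAt (fun h : ℝ => ∑ j, (r j + h * c j) ^ 2)
      (∑ j, 2 * (r j + 0 * c j) * (1 * c j)) 0 := by
    refine HasDerivAt.fun_sum fun j _ => ?_
    have := (((hasDerivAt_id (0 : ℝ)).mul_const (c j)).const_add (r j)).fun_pow 2
    simpa using this
  rw [h.deriv, Finset.mul_sum]
  exact Finset.sum_congr rfl fun j _ => by ring

theorem headPartial_eq (X : Matrix (Fin n) (Fin d) ℝ) (Y : Fin n → ℝ) (v : Fin k → ℝ)
    (B : Matrix (Fin k) (Fin d) ℝ) (i : Fin k) :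
    headPartial X Y v B i = 2 * ∑ j, (predict v B (X j) - Y j) * (B *ᵥ X j) i := by
  rw [headPartial, ← deriv_sum_sq_add_mul]
  congr 1
  funext h
  refine Finset.sum_congr rfl fun j _ => ?_
  rw [predict, add_dotProduct, single_dotProduct, predict]
  ring

theorem featurePartial_eq (X : Matrix (Fin n) (Fin d) ℝ) (Y : Fin n → ℝ) (v : Fin k → ℝ)
    (B : Matrix (Fin k) (Fin d) ℝ) (i : Fin k) (l : Fin d) :
    featurePartial X Y v B i l = 2 * ∑ j, (predict v B (X j) - Y j) * (v i * X j l) := by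
  rw [featurePartial, ← deriv_sum_sq_add_mul]
  congr 1
  funext h
  refine Finset.sum_congr rfl fun j _ => ?_
  have : Matrix.single i l h *ᵥ X j = Pi.single i (h * X j l) := by
    rw [Matrix.single_mulVec]
    rfl
  rw [predict, Matrix.add_mulVec, dotProduct_add, this, dotProduct_single, predict]
  ring

end Gradients

/-! ### Existence of the gradient flows -/

section Existence

variable {n d k : ℕ}

/-- The pairing of the fine-tuning field with its argument is the left-hand side below, so it is
bounded by the squared norm of the labels. -/
theorem neg_four_mul_sum_le (p Y : Fin n → ℝ) :
    -(4 * ∑ j, (p j - Y j) * p j) ≤ ∑ j, Y j ^ 2 := by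
  rw [Finset.mul_sum, ← Finset.sum_neg_distrib]
  exact Finset.sum_le_sum fun j _ => by nlinarith [sq_nonneg (2 * p j - Y j)]

/-- The right-hand side of the fine-tuning flow, as a vector field on one Euclidean space that
collects the entries of the head and of the feature matrix. -/
noncomputable def fineTuningField (X : Matrix (Fin n) (Fin d) ℝ) (Y : Fin n → ℝ)
    (x : EuclideanSpace ℝ (Fin k ⊕ Fin k × Fin d)) : EuclideanSpace ℝ (Fin k ⊕ Fin k × Fin d) :=
  WithLp.toLp 2 (Sum.elim
    (fun i => -headPartial X Y (fun i => x (.inl i)) (Matrix.of fun i l => x (.inr (i, l))) i)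
    (fun p => -featurePartial X Y (fun i => x (.inl i)) (Matrix.of fun i l => x (.inr (i, l)))
      p.1 p.2))

theorem contDiff_fineTuningField (X : Matrix (Fin n) (Fin d) ℝ) (Y : Fin n → ℝ) :
    ContDiff ℝ 1 (fineTuningField (k := k) X Y) := by
  rw [contDiff_euclidean]
  rintro (i | p)
  · simp only [fineTuningField, Sum.elim_inl, headPartial_eq, predict, dotProduct, Matrix.mulVec,
      Matrix.of_apply]
    fun_prop
  · simp only [fineTuningField, Sum.elim_inr, featurePartial_eq, predict, dotProduct, Matrix.mulVec,
      Matrix.of_apply]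
    fun_prop

theorem inner_fineTuningField_le (X : Matrix (Fin n) (Fin d) ℝ) (Y : Fin n → ℝ)
    (x : EuclideanSpace ℝ (Fin k ⊕ Fin k × Fin d)) :
    inner ℝ x (fineTuningField X Y x) ≤ ∑ j, Y j ^ 2 := by
  set v : Fin k → ℝ := fun i => x (.inl i) with hv
  set B : Matrix (Fin k) (Fin d) ℝ := Matrix.of fun i l => x (.inr (i, l)) with hB
  refine le_trans (le_of_eq ?_) (neg_four_mul_sum_le (fun j => predict v B (X j)) Y)
  rw [PiLp.inner_apply, Fintype.sum_sum_type, Fintype.sum_prod_type]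
  have h1 : ∑ i, inner ℝ (x (.inl i)) (fineTuningField X Y x (.inl i)) =
      -(2 * ∑ j, (predict v B (X j) - Y j) * predict v B (X j)) := by
    have : ∀ i, inner ℝ (x (.inl i)) (fineTuningField X Y x (.inl i)) =
        -(2 * ∑ j, (predict v B (X j) - Y j) * (v i * (B *ᵥ X j) i)) := by
      intro i
      change -headPartial X Y v B i * v i = _
      rw [headPartial_eq, neg_mul, mul_assoc, Finset.sum_mul]
      congr 2
      exact Finset.sum_congr rfl fun j _ => by ring
    simp_rw [this]
    rw [Finset.sum_neg_distrib, ← Finset.mul_sum, Finset.sum_comm]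
    congr 2
    refine Finset.sum_congr rfl fun j _ => ?_
    rw [← Finset.mul_sum]
    rfl
  have h2 : ∑ i, ∑ l, inner ℝ (x (.inr (i, l))) (fineTuningField X Y x (.inr (i, l))) =
      -(2 * ∑ j, (predict v B (X j) - Y j) * predict v B (X j)) := by
    have : ∀ i l, inner ℝ (x (.inr (i, l))) (fineTuningField X Y x (.inr (i, l))) =
        -(2 * ∑ j, (predict v B (X j) - Y j) * (v i * (B i l * X j l))) := by
      intro i l
      change -featurePartial X Y v B i l * B i l = _
      rw [featurePartial_eq, neg_mul, mul_assoc, Finset.sum_mul]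
      congr 2
      exact Finset.sum_congr rfl fun j _ => by ring
    simp_rw [this]
    simp_rw [Finset.sum_neg_distrib, ← Finset.mul_sum]
    congr 2
    rw [Finset.sum_congr rfl fun i _ => Finset.sum_comm, Finset.sum_comm]
    refine Finset.sum_congr rfl fun j _ => ?_
    simp_rw [← Finset.mul_sum]
    rfl
  rw [h1, h2]
  ring

theorem hasDerivWithinAt_apply {ι : Type*} [Fintype ι] {γ : ℝ → EuclideanSpace ℝ ι}
    {γ' : EuclideanSpace ℝ ι} {s : Set ℝ} {t : ℝ} (h : HasDerivWithinAt γ γ' s t) (i : ι) :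
    HasDerivWithinAt (fun r => γ r i) (γ' i) s t :=
  ((EuclideanSpace.proj i : EuclideanSpace ℝ ι →L[ℝ] ℝ).hasFDerivAt.comp_hasDerivWithinAt t h)

theorem exists_isFineTuningFlow (X : Matrix (Fin n) (Fin d) ℝ) (Y : Fin n → ℝ) (v₀ : Fin k → ℝ)
    (B₀ : Matrix (Fin k) (Fin d) ℝ) : ∃ v B, IsFineTuningFlow X Y v₀ B₀ v B := by
  obtain ⟨γ, hγ₀, hγ⟩ := exists_solution_Ici_of_inner_le (contDiff_fineTuningField (k := k) X Y)
    (inner_fineTuningField_le X Y) (WithLp.toLp 2 (Sum.elim v₀ fun p => B₀ p.1 p.2))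
  refine ⟨fun t i => γ t (.inl i), fun t => Matrix.of fun i l => γ t (.inr (i, l)), ?_, ?_,
    fun t ht => ⟨fun i => ?_, fun i l => ?_⟩⟩
  · simp [hγ₀]
  · ext i l
    simp [hγ₀]
  · exact hasDerivWithinAt_apply (hγ t ht) (.inl i)
  · exact hasDerivWithinAt_apply (hγ t ht) (.inr (i, l))

theorem exists_isLinearProbingFlow (X : Matrix (Fin n) (Fin d) ℝ) (Y : Fin n → ℝ)
    (v₀ : Fin k → ℝ) (B₀ : Matrix (Fin k) (Fin d) ℝ) : ∃ v, IsLinearProbingFlow X Y v₀ B₀ v := by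
  have hF : ContDiff ℝ 1 fun x : EuclideanSpace ℝ (Fin k) =>
      (WithLp.toLp 2 fun i => -headPartial X Y x.ofLp B₀ i : EuclideanSpace ℝ (Fin k)) := by
    rw [contDiff_euclidean]
    intro i
    simp only [headPartial_eq, predict, dotProduct, Matrix.mulVec]
    fun_prop
  have hC : ∀ x : EuclideanSpace ℝ (Fin k),
      inner ℝ x (WithLp.toLp 2 fun i => -headPartial X Y x.ofLp B₀ i : EuclideanSpace ℝ (Fin k)) ≤
        ∑ j, Y j ^ 2 := by
    intro x
    have h1 : inner ℝ x (WithLp.toLp 2 fun i => -headPartial X Y x.ofLp B₀ i :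
        EuclideanSpace ℝ (Fin k)) =
        -(2 * ∑ j, (predict x.ofLp B₀ (X j) - Y j) * predict x.ofLp B₀ (X j)) := by
      rw [PiLp.inner_apply]
      have : ∀ i, inner ℝ (x i) (-headPartial X Y x.ofLp B₀ i) =
          -(2 * ∑ j, (predict x.ofLp B₀ (X j) - Y j) * (x i * (B₀ *ᵥ X j) i)) := by
        intro i
        change -headPartial X Y x.ofLp B₀ i * x i = _
        rw [headPartial_eq, neg_mul, mul_assoc, Finset.sum_mul]
        congr 2
        exact Finset.sum_congr rfl fun j _ => by ring
      simp only [this]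
      rw [Finset.sum_neg_distrib, ← Finset.mul_sum, Finset.sum_comm]
      congr 2
      refine Finset.sum_congr rfl fun j _ => ?_
      rw [← Finset.mul_sum]
      rfl
    have h2 := neg_four_mul_sum_le (fun j => predict x.ofLp B₀ (X j)) Y
    have h3 : 0 ≤ ∑ j, Y j ^ 2 := Finset.sum_nonneg fun j _ => sq_nonneg _
    rw [h1]
    linarith
  obtain ⟨γ, hγ₀, hγ⟩ := exists_solution_Ici_of_inner_le hF hC (WithLp.toLp 2 v₀)
  exact ⟨fun t i => γ t i, by simp [hγ₀],
    fun t ht i => hasDerivWithinAt_apply (hγ t ht) i⟩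

end Existence

/-! ### Conservation laws of fine-tuning -/

section Conservation

variable {n d k : ℕ} {X : Matrix (Fin n) (Fin d) ℝ} {Y : Fin n → ℝ} {v₀ : Fin k → ℝ}
  {B₀ : Matrix (Fin k) (Fin d) ℝ} {v : ℝ → Fin k → ℝ} {B : ℝ → Matrix (Fin k) (Fin d) ℝ}

theorem eq_of_hasDerivWithinAt_zero {f : ℝ → ℝ}
    (hf : ∀ t, 0 ≤ t → HasDerivWithinAt f 0 (Set.Ici 0) t) {t : ℝ} (ht : 0 ≤ t) : f t = f 0 := by
  refine constant_of_has_deriv_right_zero (a := 0) (b := t) ?_ ?_ t ⟨ht, le_rfl⟩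
  · exact fun s hs => (hf s hs.1).continuousWithinAt.mono fun r hr => hr.1
  · exact fun s hs => (hf s hs.1).mono fun r hr => hs.1.trans hr

/-- Fine-tuning leaves the action of the features on the orthogonal complement of the training
inputs untouched. -/
theorem IsFineTuningFlow.mulVec_eq (h : IsFineTuningFlow X Y v₀ B₀ v B) {z : Fin d → ℝ}
    (hz : ∀ j, X j ⬝ᵥ z = 0) {t : ℝ} (ht : 0 ≤ t) : B t *ᵥ z = B₀ *ᵥ z := by
  obtain ⟨-, hB₀, hd⟩ := h
  funext i
  rw [← hB₀]
  refine eq_of_hasDerivWithinAt_zero (f := fun t => (B t *ᵥ z) i) (fun s hs => ?_) ht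
  have h1 : HasDerivWithinAt (fun t => ∑ l, B t i l * z l)
      (∑ l, -featurePartial X Y (v s) (B s) i l * z l) (Set.Ici 0) s :=
    HasDerivWithinAt.fun_sum fun l _ => ((hd s hs).2 i l).mul_const (z l)
  refine h1.congr_deriv (Eq.symm ?_)
  simp_rw [featurePartial_eq, neg_mul, Finset.sum_neg_distrib, mul_assoc, Finset.sum_mul,
    ← Finset.mul_sum]
  rw [Finset.sum_comm]
  have : ∀ j, ∑ l, (predict (v s) (B s) (X j) - Y j) * (v s i * X j l) * z l = 0 := by
    intro j
    have h2 : ∑ l, (predict (v s) (B s) (X j) - Y j) * (v s i * X j l) * z l =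
        (predict (v s) (B s) (X j) - Y j) * v s i * (X j ⬝ᵥ z) := by
      rw [dotProduct, Finset.mul_sum]
      exact Finset.sum_congr rfl fun l _ => by ring
    rw [h2, hz, mul_zero]
  simp [this]

/-- The matrix `v vᵀ - B Bᵀ` is conserved by fine-tuning; here as a quadratic form. -/
theorem IsFineTuningFlow.sq_sub_sq_eq (h : IsFineTuningFlow X Y v₀ B₀ v B) (u : Fin k → ℝ)
    {t : ℝ} (ht : 0 ≤ t) :
    (v t ⬝ᵥ u) ^ 2 - euclNorm ((B t)ᵀ *ᵥ u) ^ 2 =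
      (v₀ ⬝ᵥ u) ^ 2 - euclNorm (B₀ᵀ *ᵥ u) ^ 2 := by
  obtain ⟨hv₀, hB₀, hd⟩ := h
  rw [← hv₀, ← hB₀]
  refine eq_of_hasDerivWithinAt_zero
    (f := fun t => (v t ⬝ᵥ u) ^ 2 - euclNorm ((B t)ᵀ *ᵥ u) ^ 2) (fun s hs => ?_) ht
  -- `r j` is the residual at the `j`-th input, and `c` the current value of `vᵀ u`
  set r : Fin n → ℝ := fun j => predict (v s) (B s) (X j) - Y j
  set c : ℝ := v s ⬝ᵥ u
  have h1 : HasDerivWithinAt (fun t => v t ⬝ᵥ u)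
      (-(2 * ∑ j, r j * ((B s *ᵥ X j) ⬝ᵥ u))) (Set.Ici 0) s := by
    have h2 : HasDerivWithinAt (fun t => ∑ i, v t i * u i)
        (∑ i, -headPartial X Y (v s) (B s) i * u i) (Set.Ici 0) s :=
      HasDerivWithinAt.fun_sum fun i _ => ((hd s hs).1 i).mul_const (u i)
    refine h2.congr_deriv (Eq.symm ?_)
    simp_rw [headPartial_eq, neg_mul, Finset.sum_neg_distrib, mul_assoc, Finset.sum_mul,
      ← Finset.mul_sum]
    rw [Finset.sum_comm]
    congr 2
    refine Finset.sum_congr rfl fun j _ => ?_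
    rw [dotProduct, Finset.mul_sum]
    exact Finset.sum_congr rfl fun i _ => by ring
  have h3 : ∀ l, HasDerivWithinAt (fun t => ((B t)ᵀ *ᵥ u) l)
      (-(2 * ∑ j, r j * (c * X j l))) (Set.Ici 0) s := by
    intro l
    have h2 : HasDerivWithinAt (fun t => ∑ i, B t i l * u i)
        (∑ i, -featurePartial X Y (v s) (B s) i l * u i) (Set.Ici 0) s :=
      HasDerivWithinAt.fun_sum fun i _ => ((hd s hs).2 i l).mul_const (u i)
    refine h2.congr_deriv (Eq.symm ?_)
    simp_rw [featurePartial_eq, neg_mul, Finset.sum_neg_distrib, mul_assoc, Finset.sum_mul,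
      ← Finset.mul_sum]
    rw [Finset.sum_comm]
    congr 2
    refine Finset.sum_congr rfl fun j _ => ?_
    rw [show c = ∑ i, v s i * u i from rfl, Finset.sum_mul, Finset.mul_sum]
    exact Finset.sum_congr rfl fun i _ => by ring
  have h4 : HasDerivWithinAt (fun t => ∑ l, ((B t)ᵀ *ᵥ u) l ^ 2)
      (∑ l, 2 * ((B s)ᵀ *ᵥ u) l * -(2 * ∑ j, r j * (c * X j l))) (Set.Ici 0) s := by
    refine HasDerivWithinAt.fun_sum fun l _ => ?_
    simpa using (h3 l).fun_pow 2
  have h5 : (fun t => (v t ⬝ᵥ u) ^ 2 - euclNorm ((B t)ᵀ *ᵥ u) ^ 2) =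
      fun t => (v t ⬝ᵥ u) ^ 2 - ∑ l, ((B t)ᵀ *ᵥ u) l ^ 2 := by
    funext t
    rw [euclNorm_sq]
    simp only [dotProduct, sq]
  rw [h5]
  refine ((h1.fun_pow 2).fun_sub h4).congr_deriv (Eq.symm ?_)
  have h6 : ∑ l, 2 * ((B s)ᵀ *ᵥ u) l * -(2 * ∑ j, r j * (c * X j l)) =
      -(4 * c * ∑ j, r j * ((B s *ᵥ X j) ⬝ᵥ u)) := by
    have h7 : ∀ j, (B s *ᵥ X j) ⬝ᵥ u = ∑ l, ((B s)ᵀ *ᵥ u) l * X j l := by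
      intro j
      rw [dotProduct_comm, Matrix.dotProduct_mulVec, ← Matrix.mulVec_transpose]
      rfl
    simp_rw [h7, Finset.mul_sum, ← Finset.sum_neg_distrib, Finset.mul_sum]
    rw [Finset.sum_comm]
    exact Finset.sum_congr rfl fun j _ => Finset.sum_congr rfl fun l _ => by ring
  rw [h6]
  simp only [Nat.cast_ofNat]
  ring

end Conservation

/-! ### The limit of linear probing -/

section LinearProbing

variable {n d k : ℕ} {X : Matrix (Fin n) (Fin d) ℝ} {Y : Fin n → ℝ} {v₀ : Fin k → ℝ}
  {B₀ : Matrix (Fin k) (Fin d) ℝ}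

/-- If the features are injective on the training inputs, least squares has a solution. -/
theorem exists_normal_equations {τ : ℝ} (hτ : 0 < τ)
    (hX : ∀ a, τ * euclNorm a ≤ euclNorm (X *ᵥ (B₀ᵀ *ᵥ a))) (Y : Fin n → ℝ) :
    ∃ w : Fin k → ℝ, ∀ a, (X *ᵥ (B₀ᵀ *ᵥ w) - Y) ⬝ᵥ (X *ᵥ (B₀ᵀ *ᵥ a)) = 0 := by
  set G : Matrix (Fin n) (Fin k) ℝ := X * B₀ᵀ with hG
  have hGa : ∀ a, X *ᵥ (B₀ᵀ *ᵥ a) = G *ᵥ a := fun a => Matrix.mulVec_mulVec _ _ _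
  have hinj : Function.Injective (Gᵀ * G).mulVecLin := by
    rw [← LinearMap.ker_eq_bot, LinearMap.ker_eq_bot']
    intro a ha
    rw [Matrix.mulVecLin_apply, ← Matrix.mulVec_mulVec] at ha
    have h1 : euclNorm (G *ᵥ a) ^ 2 = 0 := by rw [euclNorm_sq_mulVec, ha, dotProduct_zero]
    have h2 := hX a
    rw [hGa, pow_eq_zero_iff two_ne_zero |>.1 h1] at h2
    exact euclNorm_eq_zero.1 (le_antisymm (nonpos_of_mul_nonpos_right h2 hτ) (euclNorm_nonneg a))
  obtain ⟨w, hw⟩ := LinearMap.injective_iff_surjective.1 hinj (Gᵀ *ᵥ Y)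
  rw [Matrix.mulVecLin_apply, ← Matrix.mulVec_mulVec] at hw
  refine ⟨w, fun a => ?_⟩
  rw [hGa, hGa, Matrix.dotProduct_mulVec, ← Matrix.mulVec_transpose, Matrix.mulVec_sub, hw,
    sub_self, zero_dotProduct]

/-- Linear probing converges to the least squares solution `w`; the squared distance to `w` decays
at least like `exp (-4 τ² t)`. -/
theorem IsLinearProbingFlow.tendsto {τ : ℝ} (hτ : 0 < τ)
    (hX : ∀ a, τ * euclNorm a ≤ euclNorm (X *ᵥ (B₀ᵀ *ᵥ a))) {w : Fin k → ℝ}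
    (hw : ∀ a, (X *ᵥ (B₀ᵀ *ᵥ w) - Y) ⬝ᵥ (X *ᵥ (B₀ᵀ *ᵥ a)) = 0) {v : ℝ → Fin k → ℝ}
    (h : IsLinearProbingFlow X Y v₀ B₀ v) : Tendsto v atTop (𝓝 w) := by
  obtain ⟨-, hd⟩ := h
  set c : ℝ := 4 * τ ^ 2 with hc
  have hc0 : 0 < c := by positivity
  have hderiv : ∀ s, 0 ≤ s → HasDerivWithinAt (fun t => euclNorm (v t - w) ^ 2)
      (-(4 * euclNorm (X *ᵥ (B₀ᵀ *ᵥ (v s - w))) ^ 2)) (Set.Ici 0) s := by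
    intro s hs
    have h1 : HasDerivWithinAt (fun t => ∑ i, (v t i - w i) ^ 2)
        (∑ i, 2 * (v s i - w i) * -headPartial X Y (v s) B₀ i) (Set.Ici 0) s := by
      refine HasDerivWithinAt.fun_sum fun i _ => ?_
      simpa using ((hd s hs i).sub_const (w i)).fun_pow 2
    have h2 : (fun t => euclNorm (v t - w) ^ 2) = fun t => ∑ i, (v t i - w i) ^ 2 := by
      funext t
      rw [euclNorm_sq]
      simp only [dotProduct, sq, Pi.sub_apply]
    rw [h2]
    refine h1.congr_deriv (Eq.symm ?_)
    -- by the normal equations, the residual of `w` is orthogonal to `X B₀ᵀ (v - w)`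
    have h3 : euclNorm (X *ᵥ (B₀ᵀ *ᵥ (v s - w))) ^ 2 =
        (X *ᵥ (B₀ᵀ *ᵥ v s) - Y) ⬝ᵥ (X *ᵥ (B₀ᵀ *ᵥ (v s - w))) := by
      have h4 := hw (v s - w)
      have h5 : X *ᵥ (B₀ᵀ *ᵥ (v s - w)) = (X *ᵥ (B₀ᵀ *ᵥ v s) - Y) - (X *ᵥ (B₀ᵀ *ᵥ w) - Y) := by
        rw [Matrix.mulVec_sub, Matrix.mulVec_sub]
        abel
      rw [euclNorm_sq]
      conv_lhs => enter [1]; rw [h5]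
      rw [sub_dotProduct, h4, sub_zero]
    rw [h3, dotProduct]
    simp_rw [headPartial_eq, Pi.sub_apply, mulVec_transpose_mulVec_apply, predict, dotProduct,
      Finset.mul_sum, ← Finset.sum_neg_distrib, Finset.mul_sum, Pi.sub_apply]
    rw [Finset.sum_comm]
    exact Finset.sum_congr rfl fun i _ => Finset.sum_congr rfl fun j _ => by ring
  have hbound : ∀ t, 0 ≤ t →
      euclNorm (v t - w) ^ 2 * Real.exp (c * t) ≤ euclNorm (v 0 - w) ^ 2 := by
    intro t ht
    have hg : ∀ s, 0 ≤ s → HasDerivWithinAt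
        (fun t => euclNorm (v t - w) ^ 2 * Real.exp (c * t))
        (-(4 * euclNorm (X *ᵥ (B₀ᵀ *ᵥ (v s - w))) ^ 2) * Real.exp (c * s) +
          euclNorm (v s - w) ^ 2 * (Real.exp (c * s) * c)) (Set.Ici 0) s := by
      intro s hs
      have h1 : HasDerivAt (fun t => Real.exp (c * t)) (Real.exp (c * s) * c) s := by
        simpa using ((hasDerivAt_id s).const_mul c).exp
      exact (hderiv s hs).mul h1.hasDerivWithinAt
    refine image_le_of_deriv_right_le_deriv_boundary
      (f := fun t => euclNorm (v t - w) ^ 2 * Real.exp (c * t))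
      (B := fun _ => euclNorm (v 0 - w) ^ 2) (B' := fun _ => 0) (a := 0) (b := t)
      (fun s hs => (hg s hs.1).continuousWithinAt.mono fun r hr => hr.1)
      (fun s hs => (hg s hs.1).mono fun r hr => hs.1.trans hr) (by simp) continuousOn_const
      (fun s _ => hasDerivWithinAt_const _ _ _) (fun s _ => ?_) ⟨ht, le_rfl⟩
    have h1 := pow_le_pow_left₀ (mul_nonneg hτ.le (euclNorm_nonneg _)) (hX (v s - w)) 2
    have h2 := Real.exp_pos (c * s)
    rw [mul_pow] at h1
    rw [hc]
    nlinarith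
  have hlim : Tendsto (fun t => euclNorm (v t - w) ^ 2) atTop (𝓝 0) := by
    have h1 : Tendsto (fun t => euclNorm (v 0 - w) ^ 2 * Real.exp (-(c * t))) atTop (𝓝 0) := by
      have h2 : Tendsto (fun t : ℝ => c * t) atTop atTop := tendsto_id.const_mul_atTop hc0
      simpa using (Real.tendsto_exp_neg_atTop_nhds_zero.comp h2).const_mul
        (euclNorm (v 0 - w) ^ 2)
    refine squeeze_zero' (Eventually.of_forall fun t => sq_nonneg _)
      (eventually_atTop.2 ⟨0, fun t ht => ?_⟩) h1
    have h2 := mul_le_mul_of_nonneg_right (hbound t ht) (Real.exp_nonneg (-(c * t)))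
    rwa [mul_assoc, ← Real.exp_add, add_neg_cancel, Real.exp_zero, mul_one] at h2
  rw [tendsto_pi_nhds]
  intro i
  have h3 : Tendsto (fun t => (v t i - w i)) atTop (𝓝 0) := by
    have h4 : Tendsto (fun t => √(euclNorm (v t - w) ^ 2)) atTop (𝓝 0) := by
      simpa using hlim.sqrt
    refine squeeze_zero_norm (fun t => ?_) h4
    rw [Real.sqrt_sq (euclNorm_nonneg _)]
    exact PiLp.norm_apply_le (WithLp.toLp 2 (v t - w)) i
  simpa using h3.add_const (w i)

theorem exists_isLinearProbingLimit {τ : ℝ} (hτ : 0 < τ)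
    (hX : ∀ a, τ * euclNorm a ≤ euclNorm (X *ᵥ (B₀ᵀ *ᵥ a))) (Y : Fin n → ℝ) (v₀ : Fin k → ℝ) :
    ∃ w, IsLinearProbingLimit X Y v₀ B₀ w := by
  obtain ⟨w, hw⟩ := exists_normal_equations hτ hX Y
  obtain ⟨v, hv⟩ := exists_isLinearProbingFlow X Y v₀ B₀
  exact ⟨w, v, hv, hv.tendsto hτ hX hw⟩

theorem IsLinearProbingLimit.normal_equations {τ : ℝ} (hτ : 0 < τ)
    (hX : ∀ a, τ * euclNorm a ≤ euclNorm (X *ᵥ (B₀ᵀ *ᵥ a))) {w : Fin k → ℝ}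
    (h : IsLinearProbingLimit X Y v₀ B₀ w) (a : Fin k → ℝ) :
    (X *ᵥ (B₀ᵀ *ᵥ w) - Y) ⬝ᵥ (X *ᵥ (B₀ᵀ *ᵥ a)) = 0 := by
  obtain ⟨w', hw'⟩ := exists_normal_equations hτ hX Y
  obtain ⟨v, hv, hlim⟩ := h
  rw [tendsto_nhds_unique hlim (hv.tendsto hτ hX hw')]
  exact hw' a

end LinearProbing

/-! ### The out-of-distribution loss as a quadratic form -/

section OodLoss

variable {d k : ℕ} {P : Measure (Fin d → ℝ)}

theorem integral_sq_dotProduct_eq (hmom : ∀ i, MemLp (fun x : Fin d → ℝ => x i) 2 P)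
    (y : Fin d → ℝ) : ∫ x, (x ⬝ᵥ y) ^ 2 ∂P = y ⬝ᵥ (secondMoment P *ᵥ y) := by
  have hint : ∀ i j, Integrable (fun x : Fin d → ℝ => y i * (x i * x j * y j)) P := fun i j =>
    (((hmom i).integrable_mul (hmom j)).mul_const (y j)).const_mul (y i)
  have h1 : ∀ x : Fin d → ℝ, (x ⬝ᵥ y) ^ 2 = ∑ i, ∑ j, y i * (x i * x j * y j) := by
    intro x
    rw [sq, dotProduct, Finset.sum_mul_sum]
    exact Finset.sum_congr rfl fun i _ => Finset.sum_congr rfl fun j _ => by ring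
  simp_rw [h1]
  rw [integral_finsetSum _ fun i _ => integrable_finsetSum _ fun j _ => hint i j]
  refine Finset.sum_congr rfl fun i _ => ?_
  rw [integral_finsetSum _ fun j _ => hint i j, Matrix.mulVec, dotProduct, Finset.mul_sum]
  refine Finset.sum_congr rfl fun j _ => ?_
  rw [integral_const_mul, integral_mul_const]
  rfl

theorem oodLoss_eq (hmom : ∀ i, MemLp (fun x : Fin d → ℝ => x i) 2 P)
    (vs v : Fin k → ℝ) (Bs B : Matrix (Fin k) (Fin d) ℝ) :
    oodLoss P vs Bs v B =
      (Bᵀ *ᵥ v - Bsᵀ *ᵥ vs) ⬝ᵥ (secondMoment P *ᵥ (Bᵀ *ᵥ v - Bsᵀ *ᵥ vs)) := by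
  rw [← integral_sq_dotProduct_eq hmom, oodLoss]
  refine integral_congr_ae (ae_of_all _ fun x => ?_)
  simp only [predict_eq_dotProduct, dotProduct_sub]
  ring

theorem dotProduct_secondMoment_le (y : Fin d → ℝ) :
    y ⬝ᵥ (secondMoment P *ᵥ y) ≤ matOpNorm (secondMoment P) * euclNorm y ^ 2 := by
  have h1 := (le_abs_self _).trans (abs_dotProduct_le y (secondMoment P *ᵥ y))
  have h2 := mul_le_mul_of_nonneg_left (euclNorm_mulVec_le (secondMoment P) y) (euclNorm_nonneg y)
  nlinarith

/-- The quadratic form of an invertible second moment matrix `Σ` is at least `‖Σ⁻¹‖⁻¹ ‖y‖²`, by the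
Cauchy-Schwarz inequality for that form, applied to `y` and `Σ⁻¹ y`. -/
theorem euclNorm_sq_le_dotProduct_secondMoment
    (hmom : ∀ i, MemLp (fun x : Fin d → ℝ => x i) 2 P) (hinv : IsUnit (secondMoment P))
    (y : Fin d → ℝ) :
    euclNorm y ^ 2 ≤ matOpNorm (secondMoment P)⁻¹ * (y ⬝ᵥ (secondMoment P *ᵥ y)) := by
  set S := secondMoment P with hS
  set N := matOpNorm S⁻¹ with hN
  set z := S⁻¹ *ᵥ y with hz
  have hSz : S *ᵥ z = y := by
    rw [hz, Matrix.mulVec_mulVec, Matrix.mul_nonsing_inv S ((Matrix.isUnit_iff_isUnit_det S).1 hinv),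
      Matrix.one_mulVec]
  have hsymm : Sᵀ = S := by
    ext i j
    simp only [hS, secondMoment, Matrix.transpose_apply, Matrix.of_apply]
    exact integral_congr_ae (ae_of_all _ fun x => mul_comm _ _)
  have hN0 : 0 ≤ N := matOpNorm_nonneg _
  have hzn : euclNorm z ≤ N * euclNorm y := euclNorm_mulVec_le _ _
  rcases hN0.eq_or_lt with h0 | hpos
  · rw [← h0, zero_mul] at hzn
    have hz0 : z = 0 := euclNorm_eq_zero.1 (le_antisymm hzn (euclNorm_nonneg _))
    rw [hz0, Matrix.mulVec_zero] at hSz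
    rw [← hSz, ← h0, euclNorm_eq_zero.2 rfl]
    simp
  · have hq : 0 ≤ (y - N⁻¹ • z) ⬝ᵥ (S *ᵥ (y - N⁻¹ • z)) := by
      rw [hS, ← integral_sq_dotProduct_eq hmom]
      exact integral_nonneg fun x => sq_nonneg _
    have h1 : z ⬝ᵥ (S *ᵥ y) = euclNorm y ^ 2 := by
      rw [Matrix.dotProduct_mulVec, ← Matrix.mulVec_transpose, hsymm, hSz, euclNorm_sq]
    have h2 : z ⬝ᵥ y ≤ N * euclNorm y ^ 2 := by
      have h3 := (le_abs_self _).trans (abs_dotProduct_le z y)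
      have h4 := mul_le_mul_of_nonneg_right hzn (euclNorm_nonneg y)
      nlinarith
    rw [Matrix.mulVec_sub, Matrix.mulVec_smul, hSz, sub_dotProduct, dotProduct_sub,
      dotProduct_sub] at hq
    simp only [smul_dotProduct, dotProduct_smul, smul_eq_mul, h1, ← euclNorm_sq] at hq
    have h5 : N⁻¹ * (N⁻¹ * (z ⬝ᵥ y)) ≤ N⁻¹ * euclNorm y ^ 2 := by
      refine mul_le_mul_of_nonneg_left ?_ (by positivity)
      rw [inv_mul_le_iff₀ hpos]
      exact h2
    have h6 : N⁻¹ * euclNorm y ^ 2 ≤ y ⬝ᵥ (S *ᵥ y) := by linarith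
    rwa [inv_mul_le_iff₀ hpos] at h6

end OodLoss

/-! ### Linear probing stays close to the ground truth -/

section LinearProbingBound

variable {n d k : ℕ}

/-- The least squares head on the features `B₀` is close to any reference head `u`, as measured by
the residual `X e` of `u` on the training inputs. -/
theorem euclNorm_sub_le_of_normal_equations {X : Matrix (Fin n) (Fin d) ℝ}
    {B₀ : Matrix (Fin k) (Fin d) ℝ} {wst : Fin d → ℝ} {τ : ℝ}
    (hX : ∀ a, τ * euclNorm a ≤ euclNorm (X *ᵥ (B₀ᵀ *ᵥ a))) {w : Fin k → ℝ}
    (hw : ∀ a, (X *ᵥ (B₀ᵀ *ᵥ w) - X *ᵥ wst) ⬝ᵥ (X *ᵥ (B₀ᵀ *ᵥ a)) = 0) (u : Fin k → ℝ) :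
    τ * euclNorm (w - u) ≤ euclNorm (X *ᵥ (B₀ᵀ *ᵥ u - wst)) := by
  refine (hX _).trans ?_
  set g := X *ᵥ (B₀ᵀ *ᵥ (w - u)) with hg
  have h1 : g = (X *ᵥ (B₀ᵀ *ᵥ w) - X *ᵥ wst) - X *ᵥ (B₀ᵀ *ᵥ u - wst) := by
    rw [hg, Matrix.mulVec_sub, Matrix.mulVec_sub, Matrix.mulVec_sub]
    abel
  have h2 : euclNorm g ^ 2 = -((X *ᵥ (B₀ᵀ *ᵥ u - wst)) ⬝ᵥ g) := by
    rw [euclNorm_sq]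
    nth_rewrite 1 [h1]
    rw [sub_dotProduct, hw (w - u), zero_sub]
  have h3 := (neg_le_abs _).trans (abs_dotProduct_le (X *ᵥ (B₀ᵀ *ᵥ u - wst)) g)
  rw [← h2] at h3
  rcases (euclNorm_nonneg g).eq_or_lt with h | h
  · rw [← h]
    exact euclNorm_nonneg _
  · exact le_of_mul_le_mul_right (by nlinarith) h

theorem euclNorm_transpose_mulVec_sub_le_of_normal_equations {X : Matrix (Fin n) (Fin d) ℝ}
    {B₀ : Matrix (Fin k) (Fin d) ℝ} (hB₀ : B₀ * B₀ᵀ = 1) {wst : Fin d → ℝ} {τ : ℝ} (hτ : 0 < τ)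
    (hX : ∀ a, τ * euclNorm a ≤ euclNorm (X *ᵥ (B₀ᵀ *ᵥ a))) {w : Fin k → ℝ}
    (hw : ∀ a, (X *ᵥ (B₀ᵀ *ᵥ w) - X *ᵥ wst) ⬝ᵥ (X *ᵥ (B₀ᵀ *ᵥ a)) = 0) (u : Fin k → ℝ) :
    euclNorm (B₀ᵀ *ᵥ w - wst) ≤
      euclNorm (X *ᵥ (B₀ᵀ *ᵥ u - wst)) / τ + euclNorm (B₀ᵀ *ᵥ u - wst) := by
  have h1 := euclNorm_sub_le_of_normal_equations hX hw u
  rw [mul_comm, ← le_div_iff₀ hτ] at h1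
  have h2 : B₀ᵀ *ᵥ w - wst = B₀ᵀ *ᵥ (w - u) + (B₀ᵀ *ᵥ u - wst) := by
    rw [Matrix.mulVec_sub]; abel
  rw [h2]
  refine (euclNorm_add_le _ _).trans ?_
  rw [euclNorm_transpose_mulVec_of_mul hB₀]
  linarith

end LinearProbingBound

/-! ### Fine-tuning stays away from the ground truth -/

section FineTuningBound

variable {n d k m : ℕ}

/-- A network `(v, B)` that has the same features as `B₀` on the orthogonal complement of the range
of `F`, and the same value of `v vᵀ - B Bᵀ` as `(v₀, B₀)`, cannot predict well when `v₀` is badly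
aligned: predicting well on that complement forces `v` to be close to `u`, because the features
there are almost those of the ground truth `(u, Bu)`; the conserved form, tested on `u`, then forces
`(v₀ᵀ u)²` to be close to `W⁴`. -/
theorem le_euclNorm_sub_of_conserved {W p ε δ c₁ : ℝ} (hW : 0 < W) (hp : 0 < p)
    (hδ : 0 < δ) (hδ₁ : δ ≤ 1) (hc₀ : 0 < c₁) (hc₁ : c₁ * (4 * W + 9) ≤ 1)
    (hc₂ : c₁ * (4 * (W ^ 2 + 2 * W ^ 3) + (4 * W + 9) * (1 + 2 * W)) < W ^ 4 / 16)
    (hε₁ : ε ≤ p / 2) (hε₂ : ε * W ≤ c₁ * p * δ)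
    {F : Matrix (Fin d) (Fin m) ℝ} (hF : Fᵀ * F = 1)
    {B₀ Bu : Matrix (Fin k) (Fin d) ℝ} (hBu : Bu * Buᵀ = 1)
    (hdist : matOpNorm (B₀ - Bu) ≤ ε)
    (hperp : ∀ a, p * euclNorm a ≤ euclNorm (Buᵀ *ᵥ a - F *ᵥ (Fᵀ *ᵥ (Buᵀ *ᵥ a))))
    {u v₀ : Fin k → ℝ} (hu : euclNorm u = W)
    (halign : δ * W ^ 4 / 16 ≤ |(v₀ ⬝ᵥ u) ^ 2 - W ^ 4|)
    {v : Fin k → ℝ} {B : Matrix (Fin k) (Fin d) ℝ}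
    (hcons : ∀ a, (v ⬝ᵥ a) ^ 2 - euclNorm (Bᵀ *ᵥ a) ^ 2 = (v₀ ⬝ᵥ a) ^ 2 - euclNorm a ^ 2)
    (hBQ : B * (1 - F * Fᵀ) = B₀ * (1 - F * Fᵀ)) :
    c₁ * p * δ ≤ euclNorm (Bᵀ *ᵥ v - Buᵀ *ᵥ u) := by
  by_contra! hlt
  set D := euclNorm (Bᵀ *ᵥ v - Buᵀ *ᵥ u) with hD
  set e := v - u with he
  set η := euclNorm e with hη
  have hη0 : 0 ≤ η := euclNorm_nonneg _
  have hD0 : 0 ≤ D := euclNorm_nonneg _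
  have hε0 : 0 ≤ ε := (matOpNorm_nonneg _).trans hdist
  set Q : Matrix (Fin d) (Fin d) ℝ := 1 - F * Fᵀ with hQ
  have hQx : ∀ x, Q *ᵥ x = x - F *ᵥ (Fᵀ *ᵥ x) := fun x => by
    rw [hQ, Matrix.sub_mulVec, Matrix.one_mulVec, Matrix.mulVec_mulVec]
  have hQc : ∀ x, euclNorm (Q *ᵥ x) ≤ euclNorm x := fun x => by
    rw [hQx]; exact euclNorm_sub_projection_le hF x
  have hQt : Qᵀ = Q := by
    rw [hQ, Matrix.transpose_sub, Matrix.transpose_one, Matrix.transpose_mul,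
      Matrix.transpose_transpose]
  have hQB : Q *ᵥ (Bᵀ *ᵥ v) = Q *ᵥ (B₀ᵀ *ᵥ v) := by
    have h := congrArg Matrix.transpose hBQ
    rw [Matrix.transpose_mul, Matrix.transpose_mul, hQt] at h
    rw [Matrix.mulVec_mulVec, Matrix.mulVec_mulVec, h]
  have hp1 : p ≤ 1 := by
    have h1 := hperp u
    rw [← hQx] at h1
    have h2 := h1.trans (hQc _)
    rw [euclNorm_transpose_mulVec_of_mul hBu, hu] at h2
    exact le_of_mul_le_mul_right (by linarith) hW
  have hvn : euclNorm v ≤ η + W := by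
    have h : v = e + u := by rw [he]; abel
    rw [h, ← hu]
    exact euclNorm_add_le _ _
  -- compare the predictions on the complement of the range of `F`, where `B` acts as `B₀ ≈ Bu`
  have hη1 : p * η ≤ D + ε * (η + W) := by
    have h1 : Q *ᵥ (Buᵀ *ᵥ e) = Q *ᵥ (Bᵀ *ᵥ v - Buᵀ *ᵥ u) - Q *ᵥ ((B₀ - Bu)ᵀ *ᵥ v) := by
      rw [Matrix.mulVec_sub Q, hQB, he, Matrix.transpose_sub, Matrix.sub_mulVec B₀ᵀ,
        Matrix.mulVec_sub, Matrix.mulVec_sub, Matrix.mulVec_sub]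
      abel
    have h2 := hperp e
    rw [← hQx, h1] at h2
    have h3 := h2.trans (euclNorm_sub_le _ _)
    have h4 := hQc (Bᵀ *ᵥ v - Buᵀ *ᵥ u)
    have h5 := (hQc ((B₀ - Bu)ᵀ *ᵥ v)).trans (euclNorm_transpose_mulVec_le _ _)
    have h6 : matOpNorm (B₀ - Bu) * euclNorm v ≤ ε * (η + W) :=
      mul_le_mul hdist hvn (euclNorm_nonneg _) hε0
    linarith
  have hη2 : η ≤ 4 * c₁ * δ := by
    have h1 : ε * η ≤ p / 2 * η := mul_le_mul_of_nonneg_right hε₁ hη0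
    have h2 : p * η ≤ p * (4 * c₁ * δ) := by nlinarith
    exact le_of_mul_le_mul_left h2 hp
  have hcδ : c₁ * δ ≤ c₁ := mul_le_of_le_one_right hc₀.le hδ₁
  have hη3 : η ≤ 1 := by nlinarith
  have hD2 : D ≤ c₁ * δ := by
    have h1 : c₁ * p * δ ≤ c₁ * 1 * δ := by gcongr
    linarith
  set g := Bᵀ *ᵥ u - Buᵀ *ᵥ u with hg
  -- the conserved form, tested on `e`, keeps the features from amplifying the small vector `e`
  have hBe : euclNorm (Bᵀ *ᵥ e) ≤ (W + 2) * η := by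
    refine abs_le_of_sq_le_sq' ?_ (by positivity) |>.2
    have h1 := hcons e
    have h2 : (v ⬝ᵥ e) ^ 2 ≤ (euclNorm v * η) ^ 2 := by
      rw [← sq_abs]
      exact pow_le_pow_left₀ (abs_nonneg _) (abs_dotProduct_le v e) 2
    have h3 : euclNorm v * η ≤ (W + 1) * η := mul_le_mul_of_nonneg_right (by linarith) hη0
    have h4 := pow_le_pow_left₀ (mul_nonneg (euclNorm_nonneg v) hη0) h3 2
    have h5 : euclNorm (Bᵀ *ᵥ e) ^ 2 ≤ ((W + 1) * η) ^ 2 + η ^ 2 := by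
      linarith [sq_nonneg (v₀ ⬝ᵥ e)]
    nlinarith [sq_nonneg η, mul_nonneg hW.le (sq_nonneg η)]
  have hg1 : euclNorm g ≤ c₁ * δ * (4 * W + 9) := by
    have h1 : g = (Bᵀ *ᵥ v - Buᵀ *ᵥ u) - Bᵀ *ᵥ e := by
      rw [hg, he, Matrix.mulVec_sub]; abel
    have h2 : euclNorm g ≤ D + euclNorm (Bᵀ *ᵥ e) := h1 ▸ euclNorm_sub_le _ _
    have h3 : (W + 2) * η ≤ (W + 2) * (4 * c₁ * δ) := by gcongr
    nlinarith
  have hg2 : euclNorm g ≤ 1 := by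
    have : c₁ * δ * (4 * W + 9) ≤ c₁ * (4 * W + 9) := by gcongr
    linarith
  have hBun : |euclNorm (Bᵀ *ᵥ u) - W| ≤ euclNorm g := by
    have hw : euclNorm (Buᵀ *ᵥ u) = W := by rw [euclNorm_transpose_mulVec_of_mul hBu, hu]
    have h1 : Bᵀ *ᵥ u = g + Buᵀ *ᵥ u := by rw [hg]; abel
    have h2 : Buᵀ *ᵥ u = Bᵀ *ᵥ u - g := by rw [hg]; abel
    have h3 : euclNorm (Bᵀ *ᵥ u) ≤ euclNorm g + W := by
      rw [h1, ← hw]; exact euclNorm_add_le _ _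
    have h4 : W ≤ euclNorm (Bᵀ *ᵥ u) + euclNorm g := by
      rw [← hw, h2]; exact euclNorm_sub_le _ _
    rw [abs_le]
    constructor <;> linarith
  have hpart1 : |(v ⬝ᵥ u) ^ 2 - W ^ 4| ≤ η * (W ^ 2 + 2 * W ^ 3) := by
    have h1 : v ⬝ᵥ u = W ^ 2 + e ⬝ᵥ u := by
      rw [he, sub_dotProduct, ← hu, euclNorm_sq]; ring
    have h2 : |e ⬝ᵥ u| ≤ η * W := hu ▸ abs_dotProduct_le e u
    have h3 : (v ⬝ᵥ u) ^ 2 - W ^ 4 = (e ⬝ᵥ u) * (e ⬝ᵥ u + 2 * W ^ 2) := by rw [h1]; ring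
    rw [h3, abs_mul]
    have h4 : |e ⬝ᵥ u + 2 * W ^ 2| ≤ W + 2 * W ^ 2 := by
      refine (abs_add_le _ _).trans ?_
      rw [abs_of_nonneg (show (0 : ℝ) ≤ 2 * W ^ 2 by positivity)]
      nlinarith
    calc |e ⬝ᵥ u| * |e ⬝ᵥ u + 2 * W ^ 2| ≤ (η * W) * (W + 2 * W ^ 2) :=
          mul_le_mul h2 h4 (abs_nonneg _) (by positivity)
      _ = _ := by ring
  have hpart2 : |euclNorm (Bᵀ *ᵥ u) ^ 2 - W ^ 2| ≤ euclNorm g * (1 + 2 * W) := by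
    have h3 : euclNorm (Bᵀ *ᵥ u) ^ 2 - W ^ 2 =
        (euclNorm (Bᵀ *ᵥ u) - W) * (euclNorm (Bᵀ *ᵥ u) + W) := by ring
    have h4 := (abs_le.1 hBun).2
    have h5 := euclNorm_nonneg (Bᵀ *ᵥ u)
    rw [h3, abs_mul, abs_of_nonneg (show 0 ≤ euclNorm (Bᵀ *ᵥ u) + W by linarith)]
    exact mul_le_mul hBun (by linarith) (by linarith) (euclNorm_nonneg g)
  -- the conserved form, tested on `u`
  have hfin : |(v₀ ⬝ᵥ u) ^ 2 - W ^ 4| ≤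
      η * (W ^ 2 + 2 * W ^ 3) + euclNorm g * (1 + 2 * W) := by
    have h1 := hcons u
    rw [hu] at h1
    have h2 : (v₀ ⬝ᵥ u) ^ 2 - W ^ 4 =
        ((v ⬝ᵥ u) ^ 2 - W ^ 4) - (euclNorm (Bᵀ *ᵥ u) ^ 2 - W ^ 2) := by linarith
    rw [h2]
    exact (abs_sub _ _).trans (add_le_add hpart1 hpart2)
  have h1 : η * (W ^ 2 + 2 * W ^ 3) ≤ 4 * c₁ * δ * (W ^ 2 + 2 * W ^ 3) := by gcongr
  have h2 : euclNorm g * (1 + 2 * W) ≤ c₁ * δ * (4 * W + 9) * (1 + 2 * W) := by gcongr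
  have h3 := mul_lt_mul_of_pos_left hc₂ hδ
  linarith

/-- Along fine-tuning the network never predicts the ground truth `Buᵀ u` well, if the inputs lie in
the range of `F` and the initial head is badly aligned with `u`: by the conservation laws,
`le_euclNorm_sub_of_conserved` applies at every time. -/
theorem IsFineTuningFlow.le_euclNorm_sub {W p ε δ c₁ : ℝ} (hW : 0 < W) (hp : 0 < p)
    (hδ : 0 < δ) (hδ₁ : δ ≤ 1) (hc₀ : 0 < c₁) (hc₁ : c₁ * (4 * W + 9) ≤ 1)
    (hc₂ : c₁ * (4 * (W ^ 2 + 2 * W ^ 3) + (4 * W + 9) * (1 + 2 * W)) < W ^ 4 / 16)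
    (hε₁ : ε ≤ p / 2) (hε₂ : ε * W ≤ c₁ * p * δ)
    {F : Matrix (Fin d) (Fin m) ℝ} (hF : Fᵀ * F = 1)
    {B₀ Bu : Matrix (Fin k) (Fin d) ℝ} (hB₀ : B₀ * B₀ᵀ = 1) (hBu : Bu * Buᵀ = 1)
    (hdist : matOpNorm (B₀ - Bu) ≤ ε)
    (hperp : ∀ a, p * euclNorm a ≤ euclNorm (Buᵀ *ᵥ a - F *ᵥ (Fᵀ *ᵥ (Buᵀ *ᵥ a))))
    {u v₀ : Fin k → ℝ} (hu : euclNorm u = W)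
    (halign : δ * W ^ 4 / 16 ≤ |(v₀ ⬝ᵥ u) ^ 2 - W ^ 4|)
    {X : Matrix (Fin n) (Fin d) ℝ} {Y : Fin n → ℝ} (hX : ∀ i, F *ᵥ (Fᵀ *ᵥ X i) = X i)
    {v : ℝ → Fin k → ℝ} {B : ℝ → Matrix (Fin k) (Fin d) ℝ}
    (h : IsFineTuningFlow X Y v₀ B₀ v B) {t : ℝ} (ht : 0 ≤ t) :
    c₁ * p * δ ≤ euclNorm ((B t)ᵀ *ᵥ v t - Buᵀ *ᵥ u) := by
  refine le_euclNorm_sub_of_conserved hW hp hδ hδ₁ hc₀ hc₁ hc₂ hε₁ hε₂ hF hBu hdist hperp hu halign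
    (fun a => ?_) ?_
  · rw [h.sq_sub_sq_eq a ht, euclNorm_transpose_mulVec_of_mul hB₀]
  · refine Matrix.ext_of_mulVec_single fun l => ?_
    rw [← Matrix.mulVec_mulVec, ← Matrix.mulVec_mulVec]
    refine h.mulVec_eq (fun j => ?_) ht
    have h1 : X j ⬝ᵥ ((F * Fᵀ) *ᵥ Pi.single l 1) = X j ⬝ᵥ Pi.single l 1 := by
      rw [Matrix.dotProduct_mulVec, ← Matrix.mulVec_transpose, Matrix.transpose_mul,
        Matrix.transpose_transpose, ← Matrix.mulVec_mulVec, hX]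
    rw [Matrix.sub_mulVec, Matrix.one_mulVec, dotProduct_sub, h1, sub_self]

end FineTuningBound

/-! ### The good event -/

section GoodEvent

variable {n d k m : ℕ}

/-- The training sets and initial heads for which linear probing beats fine-tuning: the inputs lie
in the range of `F`, they are short in the direction `e` (the error of the pretrained features),
they are bounded from below by `τ` on the space of features, and the initial head is badly aligned
with `u`. -/
def goodEvent (n : ℕ) (F : Matrix (Fin d) (Fin m) ℝ) (B₀ : Matrix (Fin k) (Fin d) ℝ)
    (e : Fin d → ℝ) (u : Fin k → ℝ) (ρ τ a η : ℝ) : Set ((Fin n → Fin d → ℝ) × (Fin k → ℝ)) :=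
  {x | ((∀ i, F *ᵥ (Fᵀ *ᵥ x.1 i) = x.1 i) ∧ ∑ i, (x.1 i ⬝ᵥ e) ^ 2 ≤ ρ ∧
      ∀ b, τ * euclNorm b ≤ euclNorm (Matrix.of x.1 *ᵥ (B₀ᵀ *ᵥ b))) ∧
    η ≤ |(x.2 ⬝ᵥ u) ^ 2 - a ^ 2|}

theorem measurableSet_goodEvent (F : Matrix (Fin d) (Fin m) ℝ) (B₀ : Matrix (Fin k) (Fin d) ℝ)
    (e : Fin d → ℝ) (u : Fin k → ℝ) (ρ τ a η : ℝ) :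
    MeasurableSet (goodEvent n F B₀ e u ρ τ a η) := by
  rw [goodEvent]
  simp only [Set.ofPred_and, Set.ofPred_forall]
  refine ((isClosed_iInter fun i => isClosed_eq ?_ ?_).inter ((isClosed_le ?_ continuous_const).inter
    (isClosed_iInter fun b => isClosed_le continuous_const ?_))).inter
    (isClosed_le continuous_const ?_) |>.measurableSet
  · unfold Matrix.mulVec dotProduct
    fun_prop
  · fun_prop
  · unfold dotProduct
    fun_prop
  · refine continuous_euclNorm.comp ?_
    unfold Matrix.mulVec dotProduct
    simp only [Matrix.of_apply]
    fun_prop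
  · unfold dotProduct
    fun_prop

theorem ae_forall_projection_eq {F : Matrix (Fin d) (Fin m) ℝ} (hF : Fᵀ * F = 1) :
    ∀ᵐ X ∂(Measure.pi fun _ : Fin n => idDistribution F),
      ∀ i, F *ᵥ (Fᵀ *ᵥ X i) = X i := by
  have := isProbabilityMeasure_idDistribution F
  rw [ae_all_iff]
  intro i
  have h : ∀ᵐ x ∂idDistribution F, F *ᵥ (Fᵀ *ᵥ x) = x := by
    have hms : MeasurableSet {x : Fin d → ℝ | F *ᵥ (Fᵀ *ᵥ x) = x} :=
      measurableSet_eq_fun ((measurable_mulVec_const F).comp (measurable_mulVec_const Fᵀ))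
        measurable_id
    rw [idDistribution, ae_map_iff (measurable_mulVec_const F).aemeasurable hms]
    refine ae_of_all _ fun z => ?_
    rw [Matrix.mulVec_mulVec _ Fᵀ F, hF, Matrix.one_mulVec]
  exact (measurePreserving_eval (fun _ : Fin n => idDistribution F) i).quasiMeasurePreserving.ae h

/-- The probabilities of failure are `0` for the range of `F`, `δ / 8` for the error in the direction
`e` (Markov), `δ / 4` for the lower bound on the features, and `δ / 4` for the alignment. -/
theorem le_sampleLaw_goodEvent {F : Matrix (Fin d) (Fin m) ℝ} (hF : Fᵀ * F = 1)
    {B₀ : Matrix (Fin k) (Fin d) ℝ} {e : Fin d → ℝ} {u : Fin k → ℝ} {q δ ε W : ℝ} (s : ℝ≥0)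
    (hk : 1 ≤ k) (hn : 5 * k ≤ n) (hq : 0 < q) (hq₁ : q ≤ 1)
    (hδ : 0 < δ) (hδ₁ : δ ≤ 1) (hnδ : 10 * Real.log (1 / δ) ≤ n)
    (hlow : ∀ a, q * euclNorm a ≤ euclNorm (Fᵀ *ᵥ (B₀ᵀ *ᵥ a)))
    (hup : ∀ a, euclNorm (Fᵀ *ᵥ (B₀ᵀ *ᵥ a)) ≤ euclNorm a)
    (hε : 0 < ε) (he : euclNorm e ≤ ε) (hW : 0 < W) :
    ENNReal.ofReal (1 - δ) ≤ sampleLaw n k F s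
      (goodEvent n F B₀ e u (8 * n * ε ^ 2 / δ) (q ^ 2 * √(n * δ / k) / 100) (W ^ 2)
        (δ * W ^ 4 / 16)) := by
  have := isProbabilityMeasure_idDistribution F
  have : IsProbabilityMeasure (headDistribution k s) := by unfold headDistribution; infer_instance
  have hn0 : (0 : ℝ) < n := by exact_mod_cast (by omega : 0 < n)
  set A := goodEvent n F B₀ e u (8 * n * ε ^ 2 / δ) (q ^ 2 * √(n * δ / k) / 100) (W ^ 2)
        (δ * W ^ 4 / 16) with hA
  set μ := Measure.pi fun _ : Fin n => idDistribution F with hμ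
  have hprob : IsProbabilityMeasure (sampleLaw n k F s) := by unfold sampleLaw; infer_instance
  have hAm : MeasurableSet A := measurableSet_goodEvent F B₀ e u _ _ _ _
  -- the exceptional sets of training inputs, and of initial heads
  set N₀ : Set (Fin n → Fin d → ℝ) := {X | ¬ ∀ i, F *ᵥ (Fᵀ *ᵥ X i) = X i} with hN₀
  set N₁ : Set (Fin n → Fin d → ℝ) := {X | ENNReal.ofReal (n * ε ^ 2 / (δ / 8)) ≤
    ENNReal.ofReal (∑ i, (X i ⬝ᵥ e) ^ 2)} with hN₁
  set N₂ : Set (Fin n → Fin d → ℝ) := {X | ¬ ∀ a, q ^ 2 * √(n * δ / k) / 100 * euclNorm a ≤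
    euclNorm (Matrix.of X *ᵥ (B₀ᵀ *ᵥ a))} with hN₂
  set N₃ : Set (Fin k → ℝ) := {v | |(v ⬝ᵥ u) ^ 2 - (W ^ 2) ^ 2| < δ * W ^ 4 / 16} with hN₃
  have h0 : μ N₀ = 0 := ae_forall_projection_eq hF
  have h1 : μ N₁ ≤ ENNReal.ofReal (δ / 8) := by
    refine measure_ofReal_div_le_le ?_ (by positivity) (by positivity) ?_
    · exact (Measurable.ennreal_ofReal (by unfold dotProduct; fun_prop)).aemeasurable
    · rw [lintegral_sum_sq_dotProduct]
      refine ENNReal.ofReal_le_ofReal (mul_le_mul_of_nonneg_left ?_ hn0.le)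
      exact pow_le_pow_left₀ (euclNorm_nonneg _)
        ((euclNorm_transpose_mulVec_le_of_transpose_mul hF e).trans he) 2
  have h2 : μ N₂ ≤ ENNReal.ofReal (δ / 4) :=
    measure_exists_euclNorm_lt_le F B₀ hk hn hq hq₁ hδ hδ₁ hnδ hlow hup
  have h3 : headDistribution k s N₃ ≤ ENNReal.ofReal (δ / 4) := by
    have hm : Measurable fun v : Fin k → ℝ => v ⬝ᵥ u := by unfold dotProduct; fun_prop
    have hms : MeasurableSet {y : ℝ | |y ^ 2 - (W ^ 2) ^ 2| < δ * W ^ 4 / 16} :=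
      measurableSet_lt (by fun_prop) measurable_const
    have h4 := gaussianReal_abs_sq_sub_lt_le (s * (euclNorm u ^ 2).toNNReal)
      (a := W ^ 2) (η := δ * W ^ 4 / 16) (by positivity) (by positivity) (by
        have : 0 < W ^ 4 := by positivity
        nlinarith)
    rw [← map_dotProduct_pi_gaussianReal, Measure.map_apply hm hms] at h4
    refine h4.trans (le_of_eq ?_)
    congr 1
    field_simp
    norm_num
  have hsub : Aᶜ ⊆ (N₀ ∪ N₁ ∪ N₂) ×ˢ Set.univ ∪ Set.univ ×ˢ N₃ := by
    intro x hx
    by_contra hcon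
    refine hx ?_
    have hc1 : x.1 ∉ N₀ ∪ N₁ ∪ N₂ := fun h => hcon (Or.inl ⟨h, trivial⟩)
    have hc2 : x.2 ∉ N₃ := fun h => hcon (Or.inr ⟨trivial, h⟩)
    have hx0 : x.1 ∉ N₀ := fun h => hc1 (Or.inl (Or.inl h))
    have hx1 : x.1 ∉ N₁ := fun h => hc1 (Or.inl (Or.inr h))
    have hx2 : x.1 ∉ N₂ := fun h => hc1 (Or.inr h)
    simp only [hN₀, hN₁, hN₂, hN₃, Set.mem_ofPred_eq, not_not, not_lt, not_le] at hx0 hx1 hx2 hc2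
    refine ⟨⟨hx0, ?_, hx2⟩, hc2⟩
    have h5 := (ENNReal.ofReal_lt_ofReal_iff_of_nonneg
      (Finset.sum_nonneg fun i _ => sq_nonneg _)).1 hx1
    refine h5.le.trans (le_of_eq ?_)
    field_simp
  have hcompl : sampleLaw n k F s Aᶜ ≤ ENNReal.ofReal δ := by
    calc sampleLaw n k F s Aᶜ
        ≤ sampleLaw n k F s ((N₀ ∪ N₁ ∪ N₂) ×ˢ Set.univ) +
            sampleLaw n k F s (Set.univ ×ˢ N₃) :=
          (measure_mono hsub).trans (measure_union_le _ _)
      _ = μ (N₀ ∪ N₁ ∪ N₂) + headDistribution k s N₃ := by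
          rw [sampleLaw, Measure.prod_prod, Measure.prod_prod, measure_univ, measure_univ, mul_one,
            one_mul]
      _ ≤ (0 + ENNReal.ofReal (δ / 8) + ENNReal.ofReal (δ / 4)) + ENNReal.ofReal (δ / 4) := by
          refine add_le_add ((measure_union_le _ _).trans (add_le_add
            ((measure_union_le _ _).trans (add_le_add h0.le h1)) h2)) h3
      _ = ENNReal.ofReal (5 * δ / 8) := by
          rw [zero_add, ← ENNReal.ofReal_add (by positivity) (by positivity),
            ← ENNReal.ofReal_add (by positivity) (by positivity)]
          congr 1
          ring
      _ ≤ ENNReal.ofReal δ := ENNReal.ofReal_le_ofReal (by linarith)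
  have hAc : sampleLaw n k F s A = 1 - sampleLaw n k F s Aᶜ := by
    rw [prob_compl_eq_one_sub hAm, ENNReal.sub_sub_cancel ENNReal.one_ne_top prob_le_one]
  rw [hAc, ENNReal.ofReal_sub _ hδ.le, ENNReal.ofReal_one]
  exact tsub_le_tsub_left hcompl 1

end GoodEvent

/-! ### Comparison of the two losses -/

section Comparison

variable {d k m : ℕ}

/-- The features aligned with `B₀` by an orthogonal matrix, and the head transformed accordingly,
represent the same ground truth. -/
theorem exists_aligned_features {B₀ Bs : Matrix (Fin k) (Fin d) ℝ} (hBs : Bs * Bsᵀ = 1)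
    (vs : Fin k → ℝ) {ε : ℝ} (h : featureDist B₀ Bs < ε) :
    ∃ (U : Matrix.orthogonalGroup (Fin k) ℝ),
      ((U : Matrix (Fin k) (Fin k) ℝ) * Bs) * ((U : Matrix (Fin k) (Fin k) ℝ) * Bs)ᵀ = 1 ∧
      matOpNorm (B₀ - (U : Matrix (Fin k) (Fin k) ℝ) * Bs) < ε ∧
      (∀ a, ((U : Matrix (Fin k) (Fin k) ℝ) * Bs)ᵀ *ᵥ a =
        Bsᵀ *ᵥ ((U : Matrix (Fin k) (Fin k) ℝ)ᵀ *ᵥ a)) ∧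
      (∀ a, euclNorm ((U : Matrix (Fin k) (Fin k) ℝ)ᵀ *ᵥ a) = euclNorm a) ∧
      ((U : Matrix (Fin k) (Fin k) ℝ) * Bs)ᵀ *ᵥ ((U : Matrix (Fin k) (Fin k) ℝ) *ᵥ vs) =
        Bsᵀ *ᵥ vs := by
  obtain ⟨U, hU⟩ := exists_lt_of_ciInf_lt h
  have hU1 : (U : Matrix (Fin k) (Fin k) ℝ) * (U : Matrix (Fin k) (Fin k) ℝ)ᵀ = 1 :=
    (Matrix.mem_orthogonalGroup_iff _ _).1 U.2
  have hU2 : (U : Matrix (Fin k) (Fin k) ℝ)ᵀ * (U : Matrix (Fin k) (Fin k) ℝ) = 1 :=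
    (Matrix.mem_orthogonalGroup_iff' _ _).1 U.2
  refine ⟨U, ?_, hU, fun a => ?_, fun a => euclNorm_transpose_mulVec_of_mul hU1 a, ?_⟩
  · rw [Matrix.transpose_mul, Matrix.mul_assoc, ← Matrix.mul_assoc Bs, hBs, Matrix.one_mul, hU1]
  · rw [Matrix.transpose_mul, Matrix.mulVec_mulVec]
  · rw [Matrix.transpose_mul, Matrix.mulVec_mulVec, Matrix.mul_assoc, hU2, Matrix.mul_one]

/-- The bound on the error of linear probing, for the residual `g` on the training inputs and the error
`x` of the pretrained features, both in terms of `ε`. -/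
theorem linear_probing_error_le {n : ℕ} {q δ ε g x : ℝ} (hk : 1 ≤ k) (hn : 0 < n) (hq : 0 < q)
    (hq₁ : q ≤ 1) (hδ : 0 < δ) (hδ₁ : δ ≤ 1) (hε : 0 < ε)
    (hx : x ≤ ε) (hgρ : g ^ 2 ≤ 8 * n * ε ^ 2 / δ) :
    g / ((q / 2) ^ 2 * √(n * δ / k) / 100) + x ≤ 1201 * ε * √k / (q ^ 2 * δ) := by
  have hn' : (0 : ℝ) < n := by exact_mod_cast hn
  have hk' : (1 : ℝ) ≤ k := by exact_mod_cast hk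
  have hk0 : (0 : ℝ) < k := by linarith
  have hsk : 1 ≤ √(k : ℝ) := Real.one_le_sqrt.2 hk'
  have hqδ : q ^ 2 * δ ≤ 1 := mul_le_one₀ (pow_le_one₀ hq.le hq₁) hδ.le hδ₁
  have h1 : g ≤ 3 * ε * √(n / δ) := by
    refine abs_le_of_sq_le_sq' ?_ (by positivity) |>.2
    rw [mul_pow, mul_pow, Real.sq_sqrt (by positivity)]
    refine hgρ.trans ?_
    have : 0 < ε ^ 2 * (n / δ) := by positivity
    have h2 : 8 * n * ε ^ 2 / δ = 8 * (ε ^ 2 * (n / δ)) := by ring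
    rw [h2]
    linarith
  have h2 : √(n / δ) * δ = √(n * δ / k) * √k := by
    rw [← Real.sqrt_mul (by positivity)]
    symm
    rw [Real.sqrt_eq_iff_mul_self_eq (by positivity) (by positivity), mul_mul_mul_comm,
      Real.mul_self_sqrt (by positivity)]
    field_simp
  have h3 : g / ((q / 2) ^ 2 * √(n * δ / k) / 100) ≤ 1200 * ε * √k / (q ^ 2 * δ) := by
    rw [div_le_div_iff₀ (by positivity) (by positivity)]
    calc g * (q ^ 2 * δ) ≤ 3 * ε * √(n / δ) * (q ^ 2 * δ) := by gcongr
      _ = 3 * ε * q ^ 2 * (√(n / δ) * δ) := by ring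
      _ = 3 * ε * q ^ 2 * (√(n * δ / k) * √k) := by rw [h2]
      _ = _ := by ring
  have h4 : x ≤ ε * √k / (q ^ 2 * δ) := by
    rw [le_div_iff₀ (by positivity)]
    calc x * (q ^ 2 * δ) ≤ ε * 1 := by
          refine mul_le_mul hx hqδ (by positivity) hε.le
      _ ≤ ε * √k := by gcongr
  calc _ ≤ 1200 * ε * √k / (q ^ 2 * δ) + ε * √k / (q ^ 2 * δ) := add_le_add h3 h4
    _ = _ := by ring

/-- The numerical constants: `c₁` is the constant in the lower bound on the error of fine-tuning, `c`
the one in the assumption on the distance of the features. -/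
theorem exists_constants {W κ : ℝ} (hW : 0 < W) (hκ : 1 ≤ κ) :
    ∃ c₁ c : ℝ, 0 < c₁ ∧ c₁ * (4 * W + 9) ≤ 1 ∧
      c₁ * (4 * (W ^ 2 + 2 * W ^ 3) + (4 * W + 9) * (1 + 2 * W)) < W ^ 4 / 16 ∧
      0 < c ∧ c ≤ 1 / 2 ∧ c * W ≤ c₁ ∧ c * (2000 * (1 + W) * κ) = c₁ := by
  have hκ0 : 0 < κ := by linarith
  set c₁ : ℝ := W ^ 4 / (1000 * (1 + W) ^ 5) with hc₁def
  have hW4 : 0 < W ^ 4 := by positivity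
  have hc₁0 : 0 < c₁ := by positivity
  have hpow5 : W ^ 4 ≤ (1 + W) ^ 4 := pow_le_pow_left₀ hW.le (by linarith) 4
  have hc₁W : c₁ * (1 + W) ≤ 1 / 1000 := by
    rw [hc₁def, div_mul_eq_mul_div, div_le_div_iff₀ (by positivity) (by norm_num)]
    nlinarith [mul_le_mul_of_nonneg_right hpow5 (show (0 : ℝ) ≤ 1 + W by linarith)]
  have hc₁2 : c₁ * (4 * (W ^ 2 + 2 * W ^ 3) + (4 * W + 9) * (1 + 2 * W)) < W ^ 4 / 16 := by
    have h1 : 4 * (W ^ 2 + 2 * W ^ 3) + (4 * W + 9) * (1 + 2 * W) ≤ 22 * (1 + W) ^ 5 := by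
      have h2 : (1 + W) ^ 5 = 1 + 5 * W + 10 * W ^ 2 + 10 * W ^ 3 + 5 * W ^ 4 + W ^ 5 := by ring
      have h3 : 0 < W ^ 5 := by positivity
      have h4 : 0 < W ^ 3 := by positivity
      have h5 : 0 < W ^ 2 := by positivity
      rw [h2]
      linarith
    calc _ ≤ c₁ * (22 * (1 + W) ^ 5) := mul_le_mul_of_nonneg_left h1 hc₁0.le
      _ = 22 / 1000 * W ^ 4 := by rw [hc₁def]; field_simp
      _ < W ^ 4 / 16 := by linarith
  have hc₁le : c₁ ≤ 1 / 1000 := by nlinarith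
  have hcκ : c₁ / (2000 * (1 + W) * κ) * (2000 * (1 + W) * κ) = c₁ :=
    div_mul_cancel₀ _ (by positivity)
  have hc0 : 0 < c₁ / (2000 * (1 + W) * κ) := by positivity
  set c : ℝ := c₁ / (2000 * (1 + W) * κ)
  have hWκ : 1 + W ≤ (1 + W) * κ := le_mul_of_one_le_right (by linarith) hκ
  refine ⟨c₁, c, hc₁0, by nlinarith, hc₁2, hc0, ?_, ?_, hcκ⟩
  · have : c * 1 ≤ c * (2000 * (1 + W) * κ) := mul_le_mul_of_nonneg_left (by linarith) hc0.le
    linarith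
  · have : c * W ≤ c * (2000 * (1 + W) * κ) := mul_le_mul_of_nonneg_left (by linarith) hc0.le
    linarith

/-- The consequences of the assumption on the distance `ε` of the features, with `r` for `√k` and `L`
for `log (n / δ)`; the last one says that the error bounds of linear probing and of fine-tuning are
separated by the factor `κ`. -/
theorem feature_distance_bounds {W κ c₁ c p q δ ε r L : ℝ} (hW : 0 < W) (hκ : 1 ≤ κ)
    (hc0 : 0 < c) (hcle : c ≤ 1 / 2) (hcW : c * W ≤ c₁)
    (hcκ : c * (2000 * (1 + W) * κ) = c₁) (hp : 0 < p) (hp₁ : p ≤ 1) (hq : 0 < q) (hq₁ : q ≤ 1)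
    (hδ : 0 < δ) (hδ₁ : δ ≤ 1) (hr : 1 ≤ r) (hL : 1 ≤ L)
    (hε : ε = c * (p * q ^ 2 * δ ^ 2 / (r * L))) :
    0 < ε ∧ ε ≤ p / 2 ∧ ε ≤ q / 2 ∧ ε * W ≤ c₁ * p * δ ∧
      1201 * (ε * W) * r / (q ^ 2 * δ) * κ < c₁ * p * δ := by
  have hr0 : 0 < r := by linarith
  have hL0 : 0 < L := by linarith
  have hκ0 : 0 < κ := by linarith
  have hε0 : 0 < ε := by rw [hε]; positivity
  have hq2 : q ^ 2 ≤ q := by nlinarith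
  have hδ2 : δ ^ 2 ≤ δ := by nlinarith
  have hε1 : ε * r ≤ c * (p * q ^ 2 * δ ^ 2) := by
    have h1 : ε * r = c * (p * q ^ 2 * δ ^ 2) / L := by
      rw [hε]; field_simp
    rw [h1]
    exact div_le_self (by positivity) hL
  have hε2 : ε ≤ c * (p * q ^ 2 * δ ^ 2) := (le_mul_of_one_le_right hε0.le hr).trans hε1
  refine ⟨hε0, ?_, ?_, ?_, ?_⟩
  · have h1 : p * q ^ 2 * δ ^ 2 ≤ p * 1 * 1 := by gcongr <;> linarith
    have h2 : c * (p * q ^ 2 * δ ^ 2) ≤ 1 / 2 * (p * 1 * 1) :=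
      mul_le_mul hcle h1 (by positivity) (by norm_num)
    linarith
  · have h1 : p * q ^ 2 * δ ^ 2 ≤ 1 * q * 1 := by gcongr; linarith
    have h2 : c * (p * q ^ 2 * δ ^ 2) ≤ 1 / 2 * (1 * q * 1) :=
      mul_le_mul hcle h1 (by positivity) (by norm_num)
    linarith
  · have h1 : p * q ^ 2 * δ ^ 2 ≤ p * 1 * δ := by gcongr; linarith
    calc ε * W ≤ c * (p * 1 * δ) * W := by
          refine mul_le_mul_of_nonneg_right (hε2.trans ?_) hW.le
          exact mul_le_mul_of_nonneg_left h1 hc0.le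
      _ = (c * W) * (p * δ) := by ring
      _ ≤ c₁ * (p * δ) := mul_le_mul_of_nonneg_right hcW (by positivity)
      _ = _ := by ring
  · have h1 : 1201 * (ε * W) * r / (q ^ 2 * δ) ≤ 1201 * W * (c * p * δ) := by
      rw [div_le_iff₀ (by positivity)]
      calc 1201 * (ε * W) * r = 1201 * W * (ε * r) := by ring
        _ ≤ 1201 * W * (c * (p * q ^ 2 * δ ^ 2)) := by gcongr
        _ = _ := by ring
    have hpos : 0 < c * p * δ * κ := by positivity
    calc _ ≤ 1201 * W * (c * p * δ) * κ := mul_le_mul_of_nonneg_right h1 hκ0.le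
      _ = 1201 * W * (c * p * δ * κ) := by ring
      _ < 2000 * (1 + W) * (c * p * δ * κ) := mul_lt_mul_of_pos_right (by linarith) hpos
      _ = (c * (2000 * (1 + W) * κ)) * p * δ := by ring
      _ = c₁ * p * δ := by rw [hcκ]

/-- Bounds on the errors of the predictors, separated by the condition number of the second moment
matrix, separate the losses. -/
theorem oodLoss_lt_iInf {P : Measure (Fin d → ℝ)} (hmom : ∀ i, MemLp (fun x : Fin d → ℝ => x i) 2 P)
    (hinv : IsUnit (secondMoment P)) {κ : ℝ} (hκ : 1 ≤ κ) (hcond : condNumber (secondMoment P) ≤ κ)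
    {vs w : Fin k → ℝ} {Bs B₀ : Matrix (Fin k) (Fin d) ℝ} {v : ℝ → Fin k → ℝ}
    {B : ℝ → Matrix (Fin k) (Fin d) ℝ} {x D : ℝ} (hD : 0 < D) (hxD : x * κ < D)
    (hlp : euclNorm (B₀ᵀ *ᵥ w - Bsᵀ *ᵥ vs) ≤ x)
    (hft : ∀ t, 0 ≤ t → D ≤ euclNorm ((B t)ᵀ *ᵥ v t - Bsᵀ *ᵥ vs)) :
    oodLoss P vs Bs w B₀ < ⨅ t : Set.Ici (0 : ℝ), oodLoss P vs Bs (v t) (B t) := by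
  have hκ0 : 0 < κ := by linarith
  set N := matOpNorm (secondMoment P)⁻¹ with hN
  have hlow : ∀ t, 0 ≤ t → D ^ 2 ≤ N * oodLoss P vs Bs (v t) (B t) := by
    intro t ht
    rw [oodLoss_eq hmom]
    exact (pow_le_pow_left₀ hD.le (hft t ht) 2).trans
      (euclNorm_sq_le_dotProduct_secondMoment hmom hinv _)
  have hN0 : 0 < N := by
    refine (matOpNorm_nonneg _).lt_of_ne' fun h0 => ?_
    have h1 := hlow 0 le_rfl
    rw [hN, h0, zero_mul] at h1
    have : 0 < D ^ 2 := by positivity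
    linarith
  set y := B₀ᵀ *ᵥ w - Bsᵀ *ᵥ vs with hy
  have hyκ : κ * euclNorm y ^ 2 < D ^ 2 := by
    have h1 : euclNorm y * κ < D := (mul_le_mul_of_nonneg_right hlp hκ0.le).trans_lt hxD
    have h2 := pow_lt_pow_left₀ h1 (mul_nonneg (euclNorm_nonneg y) hκ0.le) two_ne_zero
    have h3 : κ * euclNorm y ^ 2 ≤ κ ^ 2 * euclNorm y ^ 2 :=
      mul_le_mul_of_nonneg_right (by nlinarith) (sq_nonneg _)
    rw [mul_pow] at h2
    linarith
  have hlpL : oodLoss P vs Bs w B₀ < D ^ 2 / N := by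
    rw [lt_div_iff₀ hN0, oodLoss_eq hmom]
    refine lt_of_le_of_lt ?_ hyκ
    calc _ ≤ matOpNorm (secondMoment P) * euclNorm y ^ 2 * N :=
          mul_le_mul_of_nonneg_right (dotProduct_secondMoment_le y) hN0.le
      _ = condNumber (secondMoment P) * euclNorm y ^ 2 := by rw [condNumber]; ring
      _ ≤ κ * euclNorm y ^ 2 := mul_le_mul_of_nonneg_right hcond (sq_nonneg _)
  have : Nonempty (Set.Ici (0 : ℝ)) := ⟨⟨0, Set.mem_Ici.2 le_rfl⟩⟩
  refine hlpL.trans_le (le_ciInf fun t => ?_)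
  rw [div_le_iff₀ hN0, mul_comm]
  exact hlow t t.2

end Comparison

end LinearTransfer

theorem mainTheorem3 (W κ : ℝ) (hW : 0 < W) (hκ : 1 ≤ κ) :
    ∃ c : ℝ, 0 < c ∧
      ∀ (n d k m : ℕ) (_hkm : k < m) (_hmd : m + k < d)
        -- the ground truth `v⋆`, `B⋆` and the pretrained feature extractor `B₀`
        (vs : Fin k → ℝ) (Bs B₀ : Matrix (Fin k) (Fin d) ℝ)
        (_hBs : Bs * Bsᵀ = 1) (_hB₀ : B₀ * B₀ᵀ = 1)
        (_hw : euclNorm (Bsᵀ *ᵥ vs) = W)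
        -- the columns of `F` are an orthonormal basis of the ID subspace
        (F : Matrix (Fin d) (Fin m) ℝ) (_hF : Fᵀ * F = 1)
        -- the OOD distribution, with an invertible second moment matrix
        (Pood : Measure (Fin d → ℝ)) (_hP : IsProbabilityMeasure Pood)
        (_hmom : ∀ i, MemLp (fun x : Fin d → ℝ => x i) 2 Pood)
        (_hinv : IsUnit (secondMoment Pood))
        (_hcond : condNumber (secondMoment Pood) ≤ κ)
        -- the variance of the initial head, and the failure probability
        (s : ℝ≥0) (δ : ℝ) (_hδ₀ : 0 < δ) (_hδ₁ : δ ≤ 1)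
        (_hangle : 0 < cosMaxAngle (rowSpace Bs) (colSpace F))
        (_hangle' : 0 < cosMaxAngle (rowSpace Bs) (colSpace F)ᗮ)
        (_hnm : 5 * m ≤ n) (_hnδ : 10 * Real.log (1 / δ) ≤ n)
        (_hdist : featureDist B₀ Bs <
          c * (cosMaxAngle (rowSpace Bs) (colSpace F)ᗮ
            * cosMaxAngle (rowSpace Bs) (colSpace F) ^ 2 * δ ^ 2
            / (√(k : ℝ) * Real.log (n / δ)))),
        ∃ A : Set ((Fin n → Fin d → ℝ) × (Fin k → ℝ)), MeasurableSet A ∧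
          ENNReal.ofReal (1 - δ) ≤ sampleLaw n k F s A ∧
          ∀ (X : Matrix (Fin n) (Fin d) ℝ) (v₀ : Fin k → ℝ), (X, v₀) ∈ A →
            (∃ vlp, IsLinearProbingLimit X (labels X vs Bs) v₀ B₀ vlp) ∧
            (∃ v B, IsFineTuningFlow X (labels X vs Bs) v₀ B₀ v B) ∧
            ∀ (vlp : Fin k → ℝ) (v : ℝ → Fin k → ℝ) (B : ℝ → Matrix (Fin k) (Fin d) ℝ),
              IsLinearProbingLimit X (labels X vs Bs) v₀ B₀ vlp →
              IsFineTuningFlow X (labels X vs Bs) v₀ B₀ v B →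
              oodLoss Pood vs Bs vlp B₀ < ⨅ t : Set.Ici (0 : ℝ), oodLoss Pood vs Bs (v t) (B t) := by
  obtain ⟨c₁, c, hc₁0, hc₁1, hc₁2, hc0, hcle, hcW, hcκ⟩ := exists_constants hW hκ
  refine ⟨c, hc0, ?_⟩
  intro n d k m hkm hmd vs Bs B₀ hBs hB₀ hw F hF Pood hP hmom hinv hcond s δ hδ₀ hδ₁ hangle hangle'
    hnm hnδ hdist
  set q := cosMaxAngle (rowSpace Bs) (colSpace F) with hq
  set p := cosMaxAngle (rowSpace Bs) (colSpace F)ᗮ with hp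
  set ε := c * (p * q ^ 2 * δ ^ 2 / (√(k : ℝ) * Real.log (n / δ))) with hεdef
  have hvs : euclNorm vs = W := by rw [← hw, euclNorm_transpose_mulVec_of_mul hBs]
  have hk : 1 ≤ k := by
    by_contra hk0
    have hk0' : k = 0 := by omega
    subst hk0'
    rw [Subsingleton.elim vs 0, euclNorm_eq_zero.2 rfl] at hvs
    exact hW.ne hvs
  have hn10 : 10 ≤ n := by omega
  have hn10' : (10 : ℝ) ≤ n := by exact_mod_cast hn10
  have hn0 : (0 : ℝ) < n := by linarith
  have hk' : (1 : ℝ) ≤ k := by exact_mod_cast hk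
  have hsk : 1 ≤ √(k : ℝ) := Real.one_le_sqrt.2 hk'
  have hlog : 1 ≤ Real.log (n / δ) := by
    rw [Real.le_log_iff_exp_le (by positivity), le_div_iff₀ hδ₀]
    have := Real.exp_one_lt_d9
    nlinarith [Real.exp_pos 1]
  -- the orthogonal matrix `U` aligns the true features `Bs` with the pretrained ones
  obtain ⟨U, hBu, hUdist, hUt, hUn, hUvs⟩ := exists_aligned_features hBs vs hdist
  set Bu : Matrix (Fin k) (Fin d) ℝ := (U : Matrix (Fin k) (Fin k) ℝ) * Bs with hBudef
  set u : Fin k → ℝ := (U : Matrix (Fin k) (Fin k) ℝ) *ᵥ vs with hudef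
  have hu : euclNorm u = W := by rw [hudef, euclNorm_orthogonal_mulVec, hvs]
  have hlowBu : ∀ a, q * euclNorm a ≤ euclNorm (Fᵀ *ᵥ (Buᵀ *ᵥ a)) := by
    intro a
    rw [hUt, ← hUn a]
    exact cosMaxAngle_mul_euclNorm_le hBs hF hkm.le _
  have hperp : ∀ a, p * euclNorm a ≤ euclNorm (Buᵀ *ᵥ a - F *ᵥ (Fᵀ *ᵥ (Buᵀ *ᵥ a))) := by
    intro a
    rw [hUt, ← hUn a]
    exact cosMaxAngle_orthogonal_mul_euclNorm_le hBs hF hmd.le _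
  have hq1 : q ≤ 1 := by
    have h1 := (hlowBu u).trans (euclNorm_transpose_mulVec_le_of_transpose_mul hF _)
    rw [euclNorm_transpose_mulVec_of_mul hBu, hu] at h1
    exact le_of_mul_le_mul_right (by linarith) hW
  have hp1 : p ≤ 1 := by
    have h1 := (hperp u).trans (euclNorm_sub_projection_le hF _)
    rw [euclNorm_transpose_mulVec_of_mul hBu, hu] at h1
    exact le_of_mul_le_mul_right (by linarith) hW
  obtain ⟨hε0, hεp, hεq, hεW, hgap⟩ := feature_distance_bounds hW hκ hc0 hcle hcW hcκ hangle' hp1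
    hangle hq1 hδ₀ hδ₁ hsk hlog hεdef
  clear_value ε
  have hlow : ∀ a, q / 2 * euclNorm a ≤ euclNorm (Fᵀ *ᵥ (B₀ᵀ *ᵥ a)) := by
    intro a
    have h1 : Fᵀ *ᵥ (Buᵀ *ᵥ a) = Fᵀ *ᵥ (B₀ᵀ *ᵥ a) - Fᵀ *ᵥ ((B₀ - Bu)ᵀ *ᵥ a) := by
      rw [Matrix.transpose_sub, Matrix.sub_mulVec, Matrix.mulVec_sub]; abel
    have h2 := hlowBu a
    rw [h1] at h2
    have h3 := h2.trans (euclNorm_sub_le _ _)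
    have h4 := (euclNorm_transpose_mulVec_le_of_transpose_mul hF ((B₀ - Bu)ᵀ *ᵥ a)).trans
      (euclNorm_transpose_mulVec_le _ _)
    have h5 : matOpNorm (B₀ - Bu) * euclNorm a ≤ q / 2 * euclNorm a :=
      mul_le_mul_of_nonneg_right (hUdist.le.trans hεq) (euclNorm_nonneg a)
    linarith
  have hup : ∀ a, euclNorm (Fᵀ *ᵥ (B₀ᵀ *ᵥ a)) ≤ euclNorm a := fun a =>
    (euclNorm_transpose_mulVec_le_of_transpose_mul hF _).trans
      (euclNorm_transpose_mulVec_of_mul hB₀ a).le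
  have he : euclNorm (B₀ᵀ *ᵥ u - Bsᵀ *ᵥ vs) ≤ ε * W := by
    have h1 : B₀ᵀ *ᵥ u - Bsᵀ *ᵥ vs = (B₀ - Bu)ᵀ *ᵥ u := by
      rw [Matrix.transpose_sub, Matrix.sub_mulVec, hUvs]
    rw [h1, ← hu]
    exact (euclNorm_transpose_mulVec_le _ _).trans
      (mul_le_mul_of_nonneg_right hUdist.le (euclNorm_nonneg u))
  -- for these values of `ρ` and `τ` the event has probability at least `1 - δ`
  set ρ : ℝ := 8 * n * (ε * W) ^ 2 / δ with hρ
  set τ : ℝ := (q / 2) ^ 2 * √(n * δ / k) / 100 with hτ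
  have hτ0 : 0 < τ := by positivity
  refine ⟨goodEvent n F B₀ (B₀ᵀ *ᵥ u - Bsᵀ *ᵥ vs) u ρ τ (W ^ 2) (δ * W ^ 4 / 16),
    measurableSet_goodEvent _ _ _ _ _ _ _ _,
    le_sampleLaw_goodEvent hF s hk (by omega) (by positivity) (by linarith) hδ₀ hδ₁ hnδ hlow hup
      (by positivity) he hW, ?_⟩
  intro X v₀ hXv
  obtain ⟨⟨hXF, hXe, hXlow⟩, halign⟩ := hXv
  have halign' : δ * W ^ 4 / 16 ≤ |(v₀ ⬝ᵥ u) ^ 2 - W ^ 4| := by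
    have h1 : W ^ 4 = (W ^ 2) ^ 2 := by ring
    rw [h1] at halign ⊢
    exact halign
  have hXlow' : ∀ b, τ * euclNorm b ≤ euclNorm (X *ᵥ (B₀ᵀ *ᵥ b)) := hXlow
  have hXe' : euclNorm (X *ᵥ (B₀ᵀ *ᵥ u - Bsᵀ *ᵥ vs)) ^ 2 ≤ ρ := by
    rw [euclNorm_sq_mulVec_eq_sum]
    exact hXe
  refine ⟨exists_isLinearProbingLimit hτ0 hXlow' _ v₀, exists_isFineTuningFlow X _ v₀ B₀, ?_⟩
  intro vlp v B hlp hft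
  refine oodLoss_lt_iInf hmom hinv hκ hcond (by positivity) hgap ?_ fun t ht => ?_
  · have hlab : labels X vs Bs = X *ᵥ (Bsᵀ *ᵥ vs) := by
      funext j
      exact (mulVec_transpose_mulVec_apply X Bs vs j).symm
    have hne := hlp.normal_equations hτ0 hXlow'
    rw [hlab] at hne
    exact (euclNorm_transpose_mulVec_sub_le_of_normal_equations hB₀ hτ0 hXlow' hne u).trans
      (linear_probing_error_le hk (by omega) hangle hq1 hδ₀ hδ₁ (by positivity) he hXe')
  · rw [← hUvs]
    exact hft.le_euclNorm_sub hW hangle' hδ₀ hδ₁ hc₁0 hc₁1 hc₁2 hεp hεW hF hB₀ hBu hUdist.le hperp hu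
      halign' hXF ht
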